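/- Let $m\ge 2$ and let $V$ be a complex vector space of dimension $2m$ with a symplectic (nondegenerate alternating bilinear) form $\omega=\langle\cdot,\cdot\rangle$. Let $\psi\colon V^*\to V$ be the inverse of the isomorphism $u\mapsto\langle u,\cdot\rangle$, and let $\Omega=(-1)^{\binom m2}\frac1{m!}\wedge^m\omega\colon\wedge^{2m}V\to\mathbb C$. The Lagrangian involution $\mathfrak L\colon\wedge^mV\to\wedge^mV$ is the composition of the Hodge star $\wedge^mV\to(\wedge^mV)^*=\wedge^mV^*$, $\alpha\mapsto\Omega(\alpha\wedge\,\cdot\,)$ (where $\wedge^mV^*$ and $(\wedge^mV)^*$ are identified by $\langle f_1\wedge\dots\wedge f_m,\,v_1\wedge\dots\wedge v_m\rangle=\det(f_j(v_i))$), with $\wedge^m\psi\colon\wedge^mV^*\to\wedge^mV$. View the Grassmannian $\mathrm{Gr}_mV$ of $m$-dimensional linear subspaces of $V$ as a subvariety of $\mathbb P(\wedge^mV)$ by the Plücker embedding $H\mapsto\wedge^mH$. Let $Z\subset\wedge^mV$ be a linear subspace that contains the $(-1)$-eigenspace of $\mathfrak L$ and such that $\mathbb P(Z)$ is disjoint from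 $\mathrm{Gr}_mV$, and let $\pi_Z\colon\mathrm{Gr}_mV\to\mathbb P((\wedge^mV)/Z)$ be the generalized Wronski map, that is, the restriction to $\mathrm{Gr}_mV$ of the linear projection with center $\mathbb P(Z)$. Then $\mathfrak L$ is an involution, and the induced automorphism of $\mathbb P(\wedge^mV)$ maps each fiber of $\pi_Z$ on $\mathrm{Gr}_mV$ bijectively onto itself. Moreover, $\pi_Z$ has even degree over its image: there is an even number $d$ such that $\pi_Z$ has exactly $d$ preimages in $\mathrm{Gr}_mV$ over every point of some nonempty Zariski open subset of the image $\pi_Z(\mathrm{Gr}_mV)$. -/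

import Mathlib

open scoped LinearAlgebra.Projectivization

noncomputable section

namespace GenWronski

open Module

/-! ### Exterior powers: duality and the wedge product -/

section Exterior

variable {V : Type*} [AddCommGroup V] [Module ℂ V]

theorem pairingDual_bijective [FiniteDimensional ℂ V] (k : ℕ) :
    Function.Bijective (exteriorPower.pairingDual ℂ V k) := by
  classical
  let b := Module.finBasis ℂ V
  let B := b.exteriorPower k
  let B' := b.dualBasis.exteriorPower k
  have h : (exteriorPower.pairingDual ℂ V k) =
      (B'.equiv B.dualBasis (Equiv.refl _)).toLinearMap := by
    refine B'.ext fun s => ?_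
    have h1 : (⇑b.dualBasis : _ → Dual ℂ V) = b.coord := Module.Basis.coe_dualBasis b
    have h2 : exteriorPower.pairingDual ℂ V k (B' s) = exteriorPower.ιMultiDual ℂ k b s := by
      rw [exteriorPower.ιMultiDual, exteriorPower.basis_apply, h1]
    rw [h2, ← exteriorPower.basis_coord]
    simp [B]
  rw [h]
  exact (B'.equiv B.dualBasis (Equiv.refl _)).bijective

/-- The canonical identification `⋀ᵏ(V*) ≃ (⋀ᵏ V)*`, given on decomposable tensors by
`⟨f₁ ∧ ⋯ ∧ fₖ, v₁ ∧ ⋯ ∧ vₖ⟩ = det (fⱼ (vᵢ))`. -/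
def dualPairing (V : Type*) [AddCommGroup V] [Module ℂ V] [FiniteDimensional ℂ V] (k : ℕ) :
    ⋀[ℂ]^k (Dual ℂ V) ≃ₗ[ℂ] Dual ℂ (⋀[ℂ]^k V) :=
  LinearEquiv.ofBijective (exteriorPower.pairingDual ℂ V k) (pairingDual_bijective k)

/-- The wedge product `⋀ᵐ V × ⋀ᵐ V → ⋀²ᵐ V`, that is, the product of the exterior algebra. -/
def wedge (V : Type*) [AddCommGroup V] [Module ℂ V] (m : ℕ) :
    ⋀[ℂ]^m V →ₗ[ℂ] ⋀[ℂ]^m V →ₗ[ℂ] ⋀[ℂ]^(2 * m) V :=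
  LinearMap.mk₂ ℂ
    (fun α β => ⟨(α : ExteriorAlgebra ℂ V) * β, by
      rw [two_mul]
      exact SetLike.GradedMul.mul_mem (A := fun i : ℕ => ⋀[ℂ]^i V) α.2 β.2⟩)
    (fun _ _ _ => Subtype.ext (add_mul _ _ _))
    (fun _ _ _ => Subtype.ext (smul_mul_assoc _ _ _))
    (fun _ _ _ => Subtype.ext (mul_add _ _ _))
    (fun _ _ _ => Subtype.ext (mul_smul_comm _ _ _))

/-- The `m`-th wedge power `ω ∧ ⋯ ∧ ω ∈ ⋀²ᵐ V` of an element `ω ∈ ⋀² V`. -/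
def wedgePow (m : ℕ) (ω : ⋀[ℂ]^2 V) : ⋀[ℂ]^(2 * m) V :=
  ⟨(ω : ExteriorAlgebra ℂ V) ^ m, by
    rw [mul_comm]
    exact SetLike.pow_mem_graded (A := fun i : ℕ => ⋀[ℂ]^i V) m ω.2⟩

end Exterior

/-! ### The Lagrangian involution of a symplectic vector space -/

section Symplectic

variable {V : Type*} [AddCommGroup V] [Module ℂ V]

/-- An alternating bilinear form as an alternating map in two variables. -/
def altForm (ω : LinearMap.BilinForm ℂ V) (halt : ω.IsAlt) : V [⋀^Fin 2]→ₗ[ℂ] ℂ where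
  toFun v := ω (v 0) (v 1)
  map_update_add' v i x y := by fin_cases i <;> simp [Function.update]
  map_update_smul' v i c x := by fin_cases i <;> simp [Function.update]
  map_eq_zero_of_eq' v i j h hij := by
    have h01 : v 0 = v 1 := by
      fin_cases i <;> fin_cases j <;> simp_all
    rw [h01]
    exact halt _

variable [FiniteDimensional ℂ V]

/-- A symplectic form as an element of `⋀² V*`. -/
def symplecticTensor (ω : LinearMap.BilinForm ℂ V) (halt : ω.IsAlt) : ⋀[ℂ]^2 (Dual ℂ V) :=
  (dualPairing V 2).symm (exteriorPower.alternatingMapLinearEquiv (altForm ω halt))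

/-- The volume form `Ω = (-1)^(m choose 2) (1 / m!) ωᵐ : ⋀²ᵐ V → ℂ`. -/
def volumeForm (m : ℕ) (ω : LinearMap.BilinForm ℂ V) (halt : ω.IsAlt) :
    Dual ℂ (⋀[ℂ]^(2 * m) V) :=
  ((-1 : ℂ) ^ (m.choose 2) * (1 / (m.factorial : ℂ))) •
    dualPairing V (2 * m) (wedgePow m (symplecticTensor ω halt))

/-- The Hodge star `⋀ᵐ V → ⋀ᵐ V*` of a linear form `Ω` on `⋀²ᵐ V`: the element `*α` of
`⋀ᵐ V* = (⋀ᵐ V)*` is `β ↦ Ω (α ∧ β)`. -/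
def hodgeStar (m : ℕ) (Ω : Dual ℂ (⋀[ℂ]^(2 * m) V)) : ⋀[ℂ]^m V →ₗ[ℂ] ⋀[ℂ]^m (Dual ℂ V) :=
  (dualPairing V m).symm.toLinearMap ∘ₗ (wedge V m).compr₂ Ω

/-- The Lagrangian involution `𝔏 : ⋀ᵐ V → ⋀ᵐ V` of a symplectic vector space `(V, ω)` of dimension
`2m`: the Hodge star of the volume form, followed by the map `⋀ᵐ V* → ⋀ᵐ V` that is induced by
the isomorphism `ψ : V* ≃ V` inverse to `u ↦ ω(u, ·)`. -/
def lagrangianInvolution (m : ℕ) (ω : LinearMap.BilinForm ℂ V) (halt : ω.IsAlt)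
    (hω : ω.Nondegenerate) : ⋀[ℂ]^m V →ₗ[ℂ] ⋀[ℂ]^m V :=
  exteriorPower.map m (ω.toDual hω).symm.toLinearMap ∘ₗ hodgeStar m (volumeForm m ω halt)

end Symplectic

/-! ### The Grassmannian in Plücker space -/

theorem finrank_range_map_subtype {V : Type*} [AddCommGroup V] [Module ℂ V]
    [FiniteDimensional ℂ V] {m : ℕ} (H : Submodule ℂ V) (hH : finrank ℂ H = m) :
    finrank ℂ (LinearMap.range (exteriorPower.map m H.subtype)) = 1 := by
  rw [LinearMap.finrank_range_of_inj (exteriorPower.map_injective_field H.subtype_injective),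
    exteriorPower.finrank_eq, hH, Nat.choose_self]

/-- The Plücker embedding `H ↦ ⋀ᵐ H ∈ ℙ(⋀ᵐ V)` on `m`-dimensional subspaces `H` of `V`. -/
def plucker (m : ℕ) (V : Type*) [AddCommGroup V] [Module ℂ V] [FiniteDimensional ℂ V]
    (H : {H : Submodule ℂ V // finrank ℂ H = m}) : ℙ ℂ (⋀[ℂ]^m V) :=
  Projectivization.mk'' (LinearMap.range (exteriorPower.map m H.1.subtype))
    (finrank_range_map_subtype H.1 H.2)

/-- The Grassmannian `Gr_m V` of `m`-dimensional subspaces of `V`, as a subset of Plücker space. -/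
def grassmannian (m : ℕ) (V : Type*) [AddCommGroup V] [Module ℂ V] [FiniteDimensional ℂ V] :
    Set (ℙ ℂ (⋀[ℂ]^m V)) :=
  Set.range (plucker m V)

/-! ### Linear projections -/

section Projection

variable {W : Type*} [AddCommGroup W] [Module ℂ W]

/-- The set of points of the projective subspace `ℙ(Z) ⊆ ℙ(W)`. -/
def projSubspace (Z : Submodule ℂ W) : Set (ℙ ℂ W) := {x | x.submodule ≤ Z}

theorem mkQ_rep_ne_zero (Z : Submodule ℂ W) {x : ℙ ℂ W} (hx : x ∉ projSubspace Z) :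
    Z.mkQ x.rep ≠ 0 := by
  intro h
  apply hx
  rw [projSubspace, Set.mem_ofPred_eq, x.submodule_eq, Submodule.span_singleton_le_iff_mem]
  simpa using h

/-- The linear projection `π_Z : ℙ(W) ∖ ℙ(Z) → ℙ(W/Z)` with center `ℙ(Z)`, induced by the quotient
map `W → W/Z`. -/
def linearProjection (Z : Submodule ℂ W) (x : {x : ℙ ℂ W // x ∉ projSubspace Z}) : ℙ ℂ (W ⧸ Z) :=
  Projectivization.mk ℂ (Z.mkQ x.1.rep) (mkQ_rep_ne_zero Z x.2)

theorem linearProjection_mk (Z : Submodule ℂ W) (w : W) (hw : w ≠ 0)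
    (h : Projectivization.mk ℂ w hw ∉ projSubspace Z) (h' : Z.mkQ w ≠ 0) :
    linearProjection Z ⟨Projectivization.mk ℂ w hw, h⟩ = Projectivization.mk ℂ (Z.mkQ w) h' := by
  obtain ⟨a, ha⟩ := Projectivization.exists_smul_eq_mk_rep ℂ w hw
  rw [linearProjection, Projectivization.mk_eq_mk_iff]
  exact ⟨a, by rw [← ha, Units.smul_def, Units.smul_def, map_smul]⟩

/-- The restriction `π_Z : X → ℙ(W/Z)` of a linear projection to a subset `X ⊆ ℙ(W)` that is
disjoint from the center `ℙ(Z)`. -/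
def restrictedProjection (Z : Submodule ℂ W) (X : Set (ℙ ℂ W))
    (hX : Disjoint (projSubspace Z) X) (x : X) : ℙ ℂ (W ⧸ Z) :=
  linearProjection Z ⟨x.1, Set.disjoint_right.mp hX x.2⟩

end Projection

/-- The generalized Wronski map `π_Z : Gr_m V → ℙ((⋀ᵐ V)/Z)`. -/
def wronskiMap {V : Type*} [AddCommGroup V] [Module ℂ V] [FiniteDimensional ℂ V] {m : ℕ}
    (Z : Submodule ℂ (⋀[ℂ]^m V)) (hZ : Disjoint (projSubspace Z) (grassmannian m V)) :
    grassmannian m V → ℙ ℂ ((⋀[ℂ]^m V) ⧸ Z) :=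
  restrictedProjection Z (grassmannian m V) hZ

/-! ### The degree of a map over its image -/

/-- `C ⊆ ℙ(U)` is Zariski closed: it is the set of common zeros of a family of homogeneous
polynomials. A polynomial on `U` is a polynomial in linear forms on `U`. -/
def IsZariskiClosed {U : Type*} [AddCommGroup U] [Module ℂ U] (C : Set (ℙ ℂ U)) : Prop :=
  ∃ S : Set (MvPolynomial (Dual ℂ U) ℂ), (∀ p ∈ S, ∃ n : ℕ, p.IsHomogeneous n) ∧
    C = {y | ∀ p ∈ S, MvPolynomial.eval (fun l : Dual ℂ U => l y.rep) p = 0}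

/-- The map `f : X → ℙ(U)` has degree `d` over its image: the general fiber of `f` has exactly `d`
points, that is, `f` has exactly `d` preimages over each point of some nonempty (relatively)
Zariski open subset of its image. For a morphism `f` from an irreducible complex variety `X` there
is at most one such `d`; if there is one, then it is the degree of the extension of function fields
that is defined by `f` as a map from `X` to the closure of `f(X)`. -/
def HasDegreeOverImage {X U : Type*} [AddCommGroup U] [Module ℂ U] (f : X → ℙ ℂ U) (d : ℕ) :
    Prop :=
  ∃ C : Set (ℙ ℂ U), IsZariskiClosed C ∧ (Set.range f \ C).Nonempty ∧
    ∀ y ∈ Set.range f \ C, (f ⁻¹' {y}).encard = d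

end GenWronski

end

/-! Geometrically, `𝔏` replaces a subspace `H` by its `ω`-orthogonal complement. Let `b` be a basis
of `V` whose first block spans `H`, and `b'` its `ω`-dual basis. Then `𝔏` sends the wedge of the
first block of `b` to `Ω(b)` times the wedge of the second block of `b'`, which spans the complement
(`lagrangianInvolution_ιMulti`). So `𝔏` preserves the cone `X` of decomposable vectors. As `Ω(b)²`
is the Gram determinant of `b`, one gets `Ω(b) Ω(b') = 1`, and after a cancellation of signs `𝔏² =
1`. Each `𝔏 w - w` is then a `(-1)`-eigenvector, hence lies in `Z`: `𝔏` is trivial modulo `Z` and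
preserves the fibers of the projection.

For the degree, let `R` be the coordinate ring of `X`, a domain because `X` is the image of `Vᵐ`
under a polynomial map, and let `S ⊆ R` be generated by the linear forms that vanish on `Z`. Since
`X ∩ Z = 0`, `R` is finite over `S` (`finite_coordRing`). For `m ≥ 2` some decomposable vector is
not fixed, so `𝔏` induces an `S`-automorphism of `R` of order exactly two, and `[Frac R : Frac S]`
is even (`even_finrank_of_involution`). In characteristic zero this number counts the lifts of a
general point of `S` to `R` (`exists_ne_zero_encard_lifts_eq_finrank`), that is, the vectors of `X`
over a general vector of the quotient. Over a nonzero vector these correspond to the lines of the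
projective fiber (`exists_hasDegreeOverImage_even`). -/

noncomputable section

namespace GenWronski

open Module

/-! ### Generic fibers of finite extensions of domains. -/

section GenericFiber

open Polynomial

/-- A `k`-point of `A` that kills the kernel of an integral map `A → R` lifts to a `k`-point
of `R`, if `k` is algebraically closed. -/
theorem exists_algHom_comp_algebraMap_eq {k A R : Type*} [Field k] [IsAlgClosed k] [CommRing A]
    [CommRing R] [Algebra k A] [Algebra k R] [Algebra A R] [IsScalarTower k A R]
    [Algebra.IsIntegral A R] (φ : A →ₐ[k] k)
    (hφ : ∀ a, algebraMap A R a = 0 → φ a = 0) :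
    ∃ Φ : R →ₐ[k] k, ∀ a, Φ (algebraMap A R a) = φ a := by
  have hsurj : Function.Surjective φ := fun c => ⟨algebraMap k A c, by simp⟩
  have hmax : (RingHom.ker φ).IsMaximal := RingHom.ker_isMaximal_of_surjective φ hsurj
  -- Lying over: the maximal ideal `ker φ` contains the kernel of `A → R`.
  obtain ⟨Q, hQ, hQA⟩ := Ideal.exists_ideal_over_maximal_of_isIntegral (S := R) (RingHom.ker φ)
    (fun a ha => hφ a ha)
  have key : ∀ a, Ideal.Quotient.mk Q (algebraMap A R a) = algebraMap k (R ⧸ Q) (φ a) := by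
    intro a
    have h1 : a - algebraMap k A (φ a) ∈ RingHom.ker φ := by
      simp [RingHom.mem_ker]
    rw [← hQA, Ideal.mem_comap, map_sub, ← Ideal.Quotient.eq_zero_iff_mem, map_sub,
      sub_eq_zero] at h1
    rw [h1, ← IsScalarTower.algebraMap_apply]
    rfl
  let := Ideal.Quotient.field Q
  -- Integral equations over `A` specialize along `φ` to equations over `k`. As `k` is algebraically
  -- closed, this forces `R ⧸ Q = k`.
  have hint : Algebra.IsIntegral k (R ⧸ Q) := by
    refine ⟨fun x => ?_⟩
    obtain ⟨r, rfl⟩ := Ideal.Quotient.mk_surjective x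
    obtain ⟨p, hp, hpr⟩ := Algebra.IsIntegral.isIntegral (R := A) r
    refine ⟨p.map (φ : A →+* k), hp.map _, ?_⟩
    rw [eval₂_map]
    have h2 : (algebraMap k (R ⧸ Q)).comp (φ : A →+* k) =
        (Ideal.Quotient.mk Q).comp (algebraMap A R) := by
      ext a; exact (key a).symm
    rw [h2, ← hom_eval₂, hpr, map_zero]
  let e : k ≃ₐ[k] R ⧸ Q := AlgEquiv.ofBijective (Algebra.ofId k (R ⧸ Q))
    IsAlgClosed.algebraMap_bijective_of_isIntegral
  refine ⟨(e.symm : (R ⧸ Q) →ₐ[k] k).comp (Ideal.Quotient.mkₐ k Q), fun a => ?_⟩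
  change e.symm (Ideal.Quotient.mk Q (algebraMap A R a)) = _
  rw [AlgEquiv.symm_apply_eq, key a]
  rfl

/-- A polynomial that kills `θ` also kills each root of the specialization of a polynomial of
minimal degree that kills `θ`. -/
theorem eval₂_eq_zero_of_aeval_eq_zero {k S R : Type*} [Field k] [CommRing S]
    [CommRing R] [Algebra S R] (φ : S →+* k) (θ : R) (q : S[X])
    (hq : aeval θ q = 0) (hmin : ∀ h : S[X], aeval θ h = 0 → h ≠ 0 → q.natDegree ≤ h.natDegree)
    (hlc : φ q.leadingCoeff ≠ 0) (τ : k) (hτ : q.eval₂ φ τ = 0) (h : S[X])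
    (hh : aeval θ h = 0) : h.eval₂ φ τ = 0 := by
  induction hn : h.natDegree using Nat.strong_induction_on generalizing h with
  | _ n ih =>
    subst hn
    by_cases h0 : h = 0
    · simp [h0]
    have hle := hmin h hh h0
    -- One step of pseudo-division: the leading terms cancel without dividing in `S`, and the factor
    -- `q.leadingCoeff` stays nonzero under `φ`.
    set r : S[X] := C q.leadingCoeff * h -
      C h.leadingCoeff * X ^ (h.natDegree - q.natDegree) * q with hr
    have hr0 : aeval θ r = 0 := by simp [hr, hh, hq]
    have hre : φ q.leadingCoeff * h.eval₂ φ τ = r.eval₂ φ τ := by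
      simp [hr, eval₂_mul, hτ]
    suffices r.eval₂ φ τ = 0 by
      rw [this] at hre
      exact (mul_eq_zero.mp hre).resolve_left hlc
    by_cases hrz : r = 0
    · simp [hrz]
    have hdeg : r.natDegree ≤ h.natDegree := by
      refine (natDegree_sub_le _ _).trans (max_le ?_ ?_)
      · exact natDegree_C_mul_le _ _
      · refine natDegree_mul_le.trans ?_
        have := natDegree_C_mul_X_pow_le h.leadingCoeff (h.natDegree - q.natDegree)
        omega
    have hcoeff : r.coeff h.natDegree = 0 := by
      have h1 : (C h.leadingCoeff * X ^ (h.natDegree - q.natDegree) * q).coeff h.natDegree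
          = h.leadingCoeff * q.leadingCoeff := by
        rw [mul_assoc, coeff_C_mul, coeff_X_pow_mul', if_pos (Nat.sub_le _ _),
          Nat.sub_sub_self hle]
        rfl
      rw [hr, coeff_sub, h1, coeff_C_mul, mul_comm, coeff_natDegree, sub_self]
    by_cases hdn : r.natDegree = h.natDegree
    · rw [← hdn, coeff_natDegree, leadingCoeff_eq_zero] at hcoeff
      exact absurd hcoeff hrz
    · exact ih _ (lt_of_le_of_ne hdeg hdn) r hr0 rfl


/-- Every fraction of a finite extension `R` of a domain `S` has a denominator in `S`. -/
theorem exists_algebraMap_eq_mul (S : Type*) {R L : Type*} [CommRing S] [IsDomain S] [CommRing R]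
    [IsDomain R] [Algebra S R] [Module.Finite S R] [FaithfulSMul S R] [Field L] [Algebra R L]
    [IsFractionRing R L] [Algebra S L] [IsScalarTower S R L] (x : L) :
    ∃ (c : R) (d : S), d ≠ 0 ∧ algebraMap R L c = algebraMap S L d * x := by
  obtain ⟨a, b, hb, rfl⟩ := IsFractionRing.div_surjective R x
  have hb0 : b ≠ 0 := nonZeroDivisors.ne_zero hb
  obtain ⟨c, d, hd, h⟩ := Algebra.IsAlgebraic.exists_smul_eq_mul S a hb0
  refine ⟨c, d, hd, ?_⟩
  have hbL : algebraMap R L b ≠ 0 := by simpa using hb0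
  rw [← mul_div_assoc, eq_div_iff hbL, ← map_mul, mul_comm c b, ← h, Algebra.smul_def, map_mul,
    IsScalarTower.algebraMap_apply S R L]

/-- Denominators can be taken in `S`, so generators of the `S`-module `R` span `L` over `K`. -/
theorem finiteDimensional_fractionRing (S R K L : Type*) [CommRing S] [IsDomain S] [CommRing R]
    [IsDomain R] [Algebra S R] [Module.Finite S R] [FaithfulSMul S R] [Field K] [Field L]
    [Algebra S K] [IsFractionRing S K] [Algebra R L] [IsFractionRing R L] [Algebra K L]
    [Algebra S L] [IsScalarTower S K L] [IsScalarTower S R L] : FiniteDimensional K L := by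
  obtain ⟨s, hs⟩ := Module.Finite.fg_top (R := S) (M := R)
  classical
  refine ⟨⟨s.image (algebraMap R L), ?_⟩⟩
  rw [eq_top_iff]
  rintro x -
  obtain ⟨c, d, hd, h⟩ := exists_algebraMap_eq_mul S (R := R) x
  have hd' : algebraMap S K d ≠ 0 := by simpa using hd
  have hx : x = (algebraMap S K d)⁻¹ • algebraMap R L c := by
    rw [h, Algebra.smul_def, map_inv₀, IsScalarTower.algebraMap_apply S K L, inv_mul_cancel_left₀]
    simpa using hd
  rw [hx]
  refine Submodule.smul_mem _ _ ?_
  have hc : c ∈ Submodule.span S (s : Set R) := hs ▸ Submodule.mem_top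
  clear h hx
  induction hc using Submodule.span_induction with
  | mem y hy =>
    refine Submodule.subset_span ?_
    exact Finset.mem_coe.mpr (Finset.mem_image_of_mem _ hy)
  | zero => simp
  | add y z _ _ hy hz => rw [map_add]; exact add_mem hy hz
  | smul a y _ hy =>
    rw [Algebra.smul_def, map_mul, ← IsScalarTower.algebraMap_apply S R L,
      IsScalarTower.algebraMap_apply S K L, ← Algebra.smul_def]
    exact Submodule.smul_mem _ _ hy

/-- Multiplying a primitive element by a denominator from `S` moves it into `R` and does not change
the field it generates over `K`. -/
theorem exists_integral_primitive_element (S R K L : Type*) [CommRing S] [IsDomain S] [CommRing R]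
    [IsDomain R] [Algebra S R] [Module.Finite S R] [FaithfulSMul S R] [Field K] [Field L]
    [Algebra S K] [IsFractionRing S K] [Algebra R L] [IsFractionRing R L] [Algebra K L]
    [Algebra S L] [IsScalarTower S K L] [IsScalarTower S R L] [CharZero K] :
    ∃ θ : R, IntermediateField.adjoin K {algebraMap R L θ} = ⊤ := by
  have := finiteDimensional_fractionRing S R K L
  obtain ⟨α, hα⟩ := Field.exists_primitive_element K L
  obtain ⟨c, d, hd, h⟩ := exists_algebraMap_eq_mul S (R := R) α
  refine ⟨c, ?_⟩
  rw [eq_top_iff, ← hα, IntermediateField.adjoin_simple_le_iff]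
  have hd' : algebraMap K L (algebraMap S K d) ≠ 0 := by simpa using hd
  have hx : α = algebraMap K L (algebraMap S K d)⁻¹ * algebraMap R L c := by
    rw [h, map_inv₀, IsScalarTower.algebraMap_apply S K L, inv_mul_cancel_left₀ hd']
  rw [hx]
  exact mul_mem (IntermediateField.algebraMap_mem _ _)
    (IntermediateField.mem_adjoin_simple_self _ _)

/-- A polynomial over the fraction field of `S` becomes integral after multiplication by a nonzero
element of `S`. -/
theorem exists_map_eq_C_mul {S K : Type*} [CommRing S] [IsDomain S] [Field K] [Algebra S K]
    [IsFractionRing S K] (p : K[X]) :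
    ∃ (q : S[X]) (s : S), s ≠ 0 ∧ q.map (algebraMap S K) = C (algebraMap S K s) * p := by
  obtain ⟨b, hb, h⟩ := IsLocalization.integerNormalization_spec (nonZeroDivisors S) p
  refine ⟨_, b, nonZeroDivisors.ne_zero hb, h.trans ?_⟩
  rw [Algebra.smul_def]; rfl

/-- **Generic fibers of finite extensions.** If `R` is a finite extension of a domain `S` over an
algebraically closed field `k` of characteristic zero, then a general `k`-point of `S` has exactly
`[Frac R : Frac S]` lifts to a `k`-point of `R`. -/
theorem exists_ne_zero_encard_lifts_eq_finrank (k S R K L : Type*) [Field k] [IsAlgClosed k]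
    [CommRing S] [IsDomain S] [CommRing R]
    [IsDomain R] [Algebra k S] [Algebra k R] [Algebra S R] [IsScalarTower k S R]
    [Module.Finite S R] [FaithfulSMul S R] [Field K] [Field L]
    [Algebra S K] [IsFractionRing S K] [Algebra R L] [IsFractionRing R L] [Algebra K L]
    [Algebra S L] [IsScalarTower S K L] [IsScalarTower S R L] [CharZero K] :
    ∃ g : S, g ≠ 0 ∧ ∀ φ : S →ₐ[k] k, φ g ≠ 0 →
      {Φ : R →ₐ[k] k | ∀ s, Φ (algebraMap S R s) = φ s}.encard = Module.finrank K L := by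
  classical
  have := finiteDimensional_fractionRing S R K L
  obtain ⟨θ, hθ⟩ := exists_integral_primitive_element S R K L
  have hinjK : Function.Injective (algebraMap S K) := IsFractionRing.injective S K
  have hinjL : Function.Injective (algebraMap R L) := IsFractionRing.injective R L
  have haev : ∀ h : S[X], algebraMap R L (aeval θ h) =
      aeval (algebraMap R L θ) (h.map (algebraMap S K)) := fun h => by
    rw [aeval_map_algebraMap, aeval_algebraMap_apply]
  have hint : IsIntegral K (algebraMap R L θ) := Algebra.IsIntegral.isIntegral _
  -- `q` is the minimal polynomial of `θ` with denominators cleared; it need not be monic.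
  obtain ⟨q, s₀, hs₀, hq⟩ := exists_map_eq_C_mul (S := S) (minpoly K (algebraMap R L θ))
  have hs₀' : algebraMap S K s₀ ≠ 0 := by simpa using hs₀
  have hdeg : q.natDegree = Module.finrank K L := by
    rw [← natDegree_map_eq_of_injective hinjK, hq, natDegree_C_mul hs₀',
      ← IntermediateField.adjoin.finrank hint, hθ, IntermediateField.finrank_top']
  have hqθ : aeval θ q = 0 := hinjL (by rw [haev, hq]; simp)
  have hmin : ∀ h : S[X], aeval θ h = 0 → h ≠ 0 → q.natDegree ≤ h.natDegree := by
    intro h hh h0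
    rw [← natDegree_map_eq_of_injective hinjK, hq, natDegree_C_mul hs₀',
      ← natDegree_map_eq_of_injective hinjK h]
    refine natDegree_le_of_dvd (minpoly.dvd _ _ ?_) ?_
    · rw [← haev, hh, map_zero]
    · rwa [Ne, Polynomial.map_eq_zero_iff hinjK]
  -- A Bézout relation for `q` and `q'` over `S`: wherever `e` does not vanish, the specialization
  -- of `q` has simple roots.
  have hsep : ∃ (a b : S[X]) (e : S), e ≠ 0 ∧ a * q + b * derivative q = C e := by
    have h1 : (q.map (algebraMap S K)).Separable := by
      rw [hq]
      exact (Algebra.IsSeparable.isSeparable K (algebraMap R L θ)).unit_mul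
        (isUnit_C.mpr hs₀'.isUnit)
    obtain ⟨a, b, hab⟩ := h1
    obtain ⟨a', s, hs, ha⟩ := exists_map_eq_C_mul (S := S) a
    obtain ⟨b', t, ht, hb⟩ := exists_map_eq_C_mul (S := S) b
    refine ⟨C t * a', C s * b', s * t, mul_ne_zero hs ht,
      Polynomial.map_injective _ hinjK ?_⟩
    simp only [Polynomial.map_add, Polynomial.map_mul, map_C, ha, hb, ← derivative_map, map_mul]
    linear_combination (C (algebraMap S K s) * C (algebraMap S K t)) * hab
  obtain ⟨a, b, e, he, hab⟩ := hsep
  have hgen : ∀ r : R, ∃ (h : S[X]) (g : S), g ≠ 0 ∧ g • r = aeval θ h := by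
    intro r
    have h1 : algebraMap R L r ∈ Algebra.adjoin K {algebraMap R L θ} := by
      rw [← IntermediateField.adjoin_simple_toSubalgebra_of_isAlgebraic hint.isAlgebraic, hθ]
      trivial
    rw [Algebra.adjoin_singleton_eq_range_aeval] at h1
    obtain ⟨p, hp⟩ := h1
    obtain ⟨h, g, hg, hpg⟩ := exists_map_eq_C_mul (S := S) p
    refine ⟨h, g, hg, hinjL ?_⟩
    rw [haev, hpg, map_mul, aeval_C, ← IsScalarTower.algebraMap_apply S K L, Algebra.smul_def,
      map_mul, ← IsScalarTower.algebraMap_apply S R L]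
    exact congrArg _ hp.symm
  choose H G hG hGH using hgen
  obtain ⟨s, hs⟩ := Module.Finite.fg_top (R := S) (M := R)
  have hlc0 : q.leadingCoeff ≠ 0 := by
    rw [Ne, leadingCoeff_eq_zero, ← Polynomial.map_eq_zero_iff hinjK, hq]
    exact mul_ne_zero (by simpa using hs₀) (minpoly.ne_zero hint)
  -- The three factors keep the degree of `q` under specialization, keep its roots distinct, and
  -- make a lift `Φ` determined by `Φ θ`.
  refine ⟨q.leadingCoeff * e * ∏ r ∈ s, G r, mul_ne_zero (mul_ne_zero hlc0 he)
    (Finset.prod_ne_zero_iff.mpr fun r _ => hG r), fun φ hφ => ?_⟩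
  rw [map_mul, map_mul, map_prod] at hφ
  have hφq : φ q.leadingCoeff ≠ 0 := left_ne_zero_of_mul (left_ne_zero_of_mul hφ)
  have hφe : φ e ≠ 0 := right_ne_zero_of_mul (left_ne_zero_of_mul hφ)
  have hφG : ∀ r ∈ s, φ (G r) ≠ 0 := Finset.prod_ne_zero_iff.mp (right_ne_zero_of_mul hφ)
  set ρ : S →+* k := (φ : S →+* k) with hρ
  have hcomp : ∀ Φ : R →ₐ[k] k, (∀ s, Φ (algebraMap S R s) = φ s) → ∀ h : S[X],
      Φ (aeval θ h) = h.eval₂ ρ (Φ θ) := by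
    intro Φ hΦ h
    have h1 : (Φ : R →+* k).comp (algebraMap S R) = ρ := RingHom.ext hΦ
    rw [← h1, ← AlgHom.coe_toRingHom Φ, aeval_def, hom_eval₂]
  have hroots : Set.BijOn (fun Φ : R →ₐ[k] k => Φ θ)
      {Φ : R →ₐ[k] k | ∀ s, Φ (algebraMap S R s) = φ s} ((q.map ρ).rootSet k) := by
    have hq0 : q.map ρ ≠ 0 := fun h0 => hφq (by
      have := congrArg (fun p => coeff p q.natDegree) h0
      rw [coeff_map, coeff_zero] at this
      exact this)
    refine ⟨fun Φ hΦ => ?_, fun Φ hΦ Ψ hΨ h => ?_, fun τ hτ => ?_⟩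
    · rw [mem_rootSet]
      refine ⟨hq0, ?_⟩
      rw [coe_aeval_eq_eval, eval_map, ← hcomp Φ hΦ, hqθ, map_zero]
    · have h1 : ∀ r ∈ s, Φ r = Ψ r := by
        intro r hr
        refine mul_left_cancel₀ (hφG r hr) ?_
        have h2 : ∀ Φ : R →ₐ[k] k, (∀ s, Φ (algebraMap S R s) = φ s) →
            φ (G r) * Φ r = (H r).eval₂ ρ (Φ θ) := fun Φ hΦ => by
          rw [← hcomp Φ hΦ, ← hGH, Algebra.smul_def, map_mul, hΦ]
        rw [h2 Φ hΦ, h2 Ψ hΨ]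
        exact congrArg (fun t => (H r).eval₂ ρ t) h
      ext r
      have hr : r ∈ Submodule.span S (s : Set R) := hs ▸ Submodule.mem_top
      induction hr using Submodule.span_induction with
      | mem x hx => exact h1 x hx
      | zero => simp
      | add x y _ _ hx hy => rw [map_add, map_add, hx, hy]
      | smul a x _ hx => rw [Algebra.smul_def, map_mul, map_mul, hΦ, hΨ, hx]
    · rw [mem_rootSet, coe_aeval_eq_eval, eval_map] at hτ
      -- To realize a root `τ`, extend `φ` to `S[X]` by `X ↦ τ` and lift along `X ↦ θ`. The kernel
      -- condition holds because `τ` is a root of every specialized relation on `θ`.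
      let : Algebra S[X] R := (aeval θ : S[X] →ₐ[S] R).toAlgebra
      have halg : ∀ h : S[X], algebraMap S[X] R h = aeval θ h := fun _ => rfl
      have : IsScalarTower S S[X] R := .of_algebraMap_eq fun x => by
        rw [halg]; simp
      have : IsScalarTower k S[X] R := .of_algebraMap_eq fun x => by
        rw [halg, IsScalarTower.algebraMap_apply k S S[X], IsScalarTower.algebraMap_apply k S R]
        simp
      have : Algebra.IsIntegral S[X] R := Algebra.IsIntegral.tower_top S
      let φX : S[X] →ₐ[k] k :=
        { eval₂RingHom ρ τ with
          commutes' := fun c => by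
            change eval₂ ρ τ (algebraMap k S[X] c) = c
            rw [IsScalarTower.algebraMap_apply k S S[X]]
            simp [hρ] }
      obtain ⟨Φ, hΦ⟩ := exists_algHom_comp_algebraMap_eq (R := R) φX fun h hh =>
        eval₂_eq_zero_of_aeval_eq_zero ρ θ q hqθ hmin hφq τ hτ.2 h hh
      refine ⟨Φ, fun x => ?_, ?_⟩
      · rw [IsScalarTower.algebraMap_apply S S[X] R, hΦ]
        change eval₂ ρ τ _ = _
        simp [hρ]
      · have h2 := hΦ X
        rw [halg, aeval_X] at h2
        refine h2.trans ?_
        change eval₂ ρ τ X = _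
        simp
  have hsepρ : (q.map ρ).Separable := by
    have h1 := congrArg (Polynomial.map ρ) hab
    simp only [Polynomial.map_add, Polynomial.map_mul, map_C, ← derivative_map] at h1
    refine ⟨C (φ e)⁻¹ * a.map ρ, C (φ e)⁻¹ * b.map ρ, ?_⟩
    have h2 : (C (φ e)⁻¹ * C (ρ e) : k[X]) = 1 := by
      rw [← C_mul]
      change C ((φ e)⁻¹ * φ e) = 1
      rw [inv_mul_cancel₀ hφe, C_1]
    linear_combination C (φ e)⁻¹ * h1 + h2
  rw [← hroots.injOn.encard_image, hroots.image_eq, ← Set.coe_fintypeCard,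
    card_rootSet_eq_natDegree hsepρ (IsAlgClosed.splits _),
    natDegree_map_of_leadingCoeff_ne_zero ρ hφq, hdeg]

/-- A finite extension of domains with a nontrivial involution over the base has even degree. -/
theorem even_finrank_of_involution (S R K L : Type*) [CommRing S] [IsDomain S] [CommRing R]
    [IsDomain R] [Algebra S R] [Module.Finite S R] [FaithfulSMul S R] [Field K] [Field L]
    [Algebra S K] [IsFractionRing S K] [Algebra R L] [IsFractionRing R L] [Algebra K L]
    [Algebra S L] [IsScalarTower S K L] [IsScalarTower S R L] (σ : R ≃ₐ[S] R)
    (hσ : σ ≠ 1) (hσ2 : σ * σ = 1) : Even (Module.finrank K L) := by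
  have := finiteDimensional_fractionRing S R K L
  let f := IsFractionRing.fieldEquivOfAlgEquivHom (A := S) (B := R) K L
  have hf : Function.Injective f := IsFractionRing.fieldEquivOfAlgEquivHom_injective S R K L
  have h2 : orderOf (f σ) = 2 := by
    refine orderOf_eq_prime ?_ ?_
    · rw [← map_pow, pow_two, hσ2, map_one]
    · rw [← map_one f]
      exact fun h => hσ (hf h)
  -- Artin: `L` has degree 2 over the fixed field of an automorphism of order 2, and the tower law
  -- finishes.
  have h3 : Module.finrank (IntermediateField.fixedField (Subgroup.zpowers (f σ))) L = 2 := by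
    rw [IntermediateField.finrank_fixedField_eq_card, Nat.card_zpowers, h2]
  rw [← Module.finrank_mul_finrank K (IntermediateField.fixedField (Subgroup.zpowers (f σ))) L, h3]
  exact even_two.mul_left _

/-- If a finite extension `R` of a domain `S` over `k` has a nontrivial involution, then a general
`k`-point of `S` has an even number `d` of lifts to `R`, with `d` independent of the point. -/
theorem exists_even_encard_lifts (k S R : Type*) [Field k] [IsAlgClosed k] [CharZero k]
    [CommRing S] [IsDomain S] [CommRing R] [IsDomain R] [Algebra k S] [Algebra k R] [Algebra S R]
    [IsScalarTower k S R] [Module.Finite S R] [FaithfulSMul S R] (σ : R ≃ₐ[S] R)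
    (hσ : σ ≠ 1) (hσ2 : σ * σ = 1) :
    ∃ (g : S) (d : ℕ), g ≠ 0 ∧ Even d ∧ ∀ φ : S →ₐ[k] k, φ g ≠ 0 →
      {Φ : R →ₐ[k] k | ∀ s, Φ (algebraMap S R s) = φ s}.encard = d := by
  let : Algebra (FractionRing S) (FractionRing R) := FractionRing.liftAlgebra S (FractionRing R)
  have : IsScalarTower S (FractionRing S) (FractionRing R) :=
    FractionRing.isScalarTower_liftAlgebra S (FractionRing R)
  have : CharZero (FractionRing S) :=
    charZero_of_injective_algebraMap
      ((IsFractionRing.injective S (FractionRing S)).comp (algebraMap k S).injective :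
        Function.Injective ((algebraMap S (FractionRing S)).comp (algebraMap k S)))
  obtain ⟨g, hg, h⟩ := exists_ne_zero_encard_lifts_eq_finrank k S R (FractionRing S)
    (FractionRing R)
  exact ⟨g, _, hg, even_finrank_of_involution S R _ _ σ hσ hσ2, h⟩

end GenericFiber

/-! ### Homogeneous components and scaling. -/

section HomogeneousEval

variable {ι : Type*}

theorem eval_smul_of_isHomogeneous {p : MvPolynomial ι ℂ} {n : ℕ} (hp : p.IsHomogeneous n) (t : ℂ)
    (c : ι → ℂ) : MvPolynomial.eval (t • c) p = t ^ n * MvPolynomial.eval c p := by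
  rw [MvPolynomial.eval_eq, MvPolynomial.eval_eq, Finset.mul_sum]
  refine Finset.sum_congr rfl fun d hd => ?_
  have h : d.degree = n := by
    by_contra h
    exact (MvPolynomial.mem_support_iff.mp hd) (hp.coeff_eq_zero h)
  simp only [Pi.smul_apply, smul_eq_mul, mul_pow, Finset.prod_mul_distrib]
  rw [Finset.prod_pow_eq_pow_sum, ← Finsupp.degree_apply, h]
  ring

theorem eval_smul_eq_sum (p : MvPolynomial ι ℂ) (t : ℂ) (c : ι → ℂ) :
    MvPolynomial.eval (t • c) p = ∑ n ∈ Finset.range (p.totalDegree + 1),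
      t ^ n * MvPolynomial.eval c (MvPolynomial.homogeneousComponent n p) := by
  conv_lhs => rw [← MvPolynomial.sum_homogeneousComponent p, map_sum]
  exact Finset.sum_congr rfl fun n _ =>
    eval_smul_of_isHomogeneous (MvPolynomial.homogeneousComponent_isHomogeneous n p) t c

/-- A polynomial that vanishes on a punctured line through the origin has homogeneous components
that vanish on the line. -/
theorem eval_homogeneousComponent_eq_zero (p : MvPolynomial ι ℂ) (c : ι → ℂ)
    (h : ∀ t : ℂ, t ≠ 0 → MvPolynomial.eval (t • c) p = 0) (n : ℕ) :
    MvPolynomial.eval c (MvPolynomial.homogeneousComponent n p) = 0 := by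
  -- `q` is `t ↦ p (t • c)` as a polynomial in `t`; it has infinitely many roots, so its
  -- coefficients vanish.
  set q : Polynomial ℂ := ∑ n ∈ Finset.range (p.totalDegree + 1),
    Polynomial.monomial n (MvPolynomial.eval c (MvPolynomial.homogeneousComponent n p)) with hq
  have hq0 : q = 0 := by
    refine Polynomial.eq_zero_of_infinite_isRoot q
      (((Set.finite_singleton (0 : ℂ)).infinite_compl).mono fun t ht => ?_)
    change q.eval t = 0
    rw [← h t ht, eval_smul_eq_sum, hq, Polynomial.eval_finsetSum]
    simp [mul_comm]
  by_cases hn : n < p.totalDegree + 1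
  · have h1 := congrArg (fun q : Polynomial ℂ => q.coeff n) hq0
    simpa [hq, Polynomial.finsetSum_coeff, Polynomial.coeff_monomial, hn] using h1
  · rw [MvPolynomial.homogeneousComponent_eq_zero _ _ (by omega), map_zero]

end HomogeneousEval

/-! ### Polynomial functions on subsets of a vector space -/

section Coordinate

variable {W : Type*} [AddCommGroup W] [Module ℂ W]

/-- The algebra of polynomial functions on a vector space. -/
def polyFun (W : Type*) [AddCommGroup W] [Module ℂ W] : Subalgebra ℂ (W → ℂ) :=
  Algebra.adjoin ℂ (Set.range fun l : Dual ℂ W => (l : W → ℂ))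

/-- The algebra of polynomial functions on a subset of a vector space. -/
def coordRing (X : Set W) : Subalgebra ℂ (X → ℂ) :=
  Algebra.adjoin ℂ (Set.range fun (l : Dual ℂ W) (x : X) => l x)

/-- The restriction of a linear form to a subset. -/
def linFun (X : Set W) (l : Dual ℂ W) : coordRing X :=
  ⟨fun x => l x, Algebra.subset_adjoin ⟨l, rfl⟩⟩

/-- `X` is the common zero set of the polynomial functions that vanish on it. -/
def IsPolyClosed (X : Set W) : Prop :=
  ∀ w ∉ X, ∃ p ∈ polyFun W, (∀ x ∈ X, p x = 0) ∧ p w ≠ 0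

/-- The subalgebra of `coordRing X` generated by the linear forms that vanish on `Z`. -/
def projRing (X : Set W) (Z : Submodule ℂ W) : Subalgebra ℂ (coordRing X) :=
  Algebra.adjoin ℂ (Set.range fun l : Dual ℂ (W ⧸ Z) => linFun X (l ∘ₗ Z.mkQ))

theorem linFun_mem_polyFun (l : Dual ℂ W) : (l : W → ℂ) ∈ polyFun W :=
  Algebra.subset_adjoin ⟨l, rfl⟩

theorem linFun_mem_projRing (X : Set W) (Z : Submodule ℂ W) (l : Dual ℂ (W ⧸ Z)) :
    linFun X (l ∘ₗ Z.mkQ) ∈ projRing X Z :=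
  Algebra.subset_adjoin ⟨l, rfl⟩

variable {ι : Type*} (b : Basis ι ℂ W)

/-- A polynomial in coordinates as an element of the coordinate ring. -/
def coordEval (X : Set W) : MvPolynomial ι ℂ →ₐ[ℂ] coordRing X :=
  MvPolynomial.aeval fun i => linFun X (b.coord i)

theorem coordEval_apply (X : Set W) (p : MvPolynomial ι ℂ) (x : X) :
    (coordEval b X p).1 x = MvPolynomial.eval (b.repr x) p := by
  induction p using MvPolynomial.induction_on with
  | C a => simp [coordEval]
  | add p q hp hq =>
    rw [map_add, map_add, ← hp, ← hq]; rfl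
  | mul_X p i hp =>
    rw [map_mul, map_mul, ← hp, MvPolynomial.eval_X]
    simp [coordEval, linFun]

theorem eq_sum_coord [Fintype ι] (l : Dual ℂ W) (w : W) : l w = ∑ i, b.repr w i * l (b i) := by
  conv_lhs => rw [← b.sum_repr w, map_sum]
  simp

theorem linFun_eq_coordEval [Fintype ι] (X : Set W) (l : Dual ℂ W) :
    linFun X l = coordEval b X (∑ i, MvPolynomial.C (l (b i)) * MvPolynomial.X i) := by
  ext x
  rw [coordEval_apply, map_sum]
  refine (eq_sum_coord b l x).trans (Finset.sum_congr rfl fun i _ => ?_)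
  simp [mul_comm]

theorem coordEval_surjective [Finite ι] (X : Set W) : Function.Surjective (coordEval b X) := by
  have := Fintype.ofFinite ι
  rintro ⟨f, hf⟩
  induction hf using Algebra.adjoin_induction with
  | mem f hf =>
    obtain ⟨l, rfl⟩ := hf
    exact ⟨_, (linFun_eq_coordEval b X l).symm⟩
  | algebraMap c => exact ⟨algebraMap _ _ c, AlgHom.commutes _ _⟩
  | add f g hf hg ihf ihg =>
    obtain ⟨p, hp⟩ := ihf
    obtain ⟨q, hq⟩ := ihg
    exact ⟨p + q, by rw [map_add, hp, hq]; rfl⟩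
  | mul f g hf hg ihf ihg =>
    obtain ⟨p, hp⟩ := ihf
    obtain ⟨q, hq⟩ := ihg
    exact ⟨p * q, by rw [map_mul, hp, hq]; rfl⟩

theorem exists_eval_eq_of_mem_polyFun [Finite ι] {f : W → ℂ} (hf : f ∈ polyFun W) :
    ∃ p : MvPolynomial ι ℂ, ∀ w, f w = MvPolynomial.eval (b.repr w) p := by
  have := Fintype.ofFinite ι
  induction hf using Algebra.adjoin_induction with
  | mem f hf =>
    obtain ⟨l, rfl⟩ := hf
    refine ⟨∑ i, MvPolynomial.C (l (b i)) * MvPolynomial.X i, fun w => ?_⟩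
    rw [map_sum]
    refine (eq_sum_coord b l w).trans (Finset.sum_congr rfl fun i _ => ?_)
    simp [mul_comm]
  | algebraMap c => exact ⟨MvPolynomial.C c, fun w => by simp⟩
  | add f g hf hg ihf ihg =>
    obtain ⟨p, hp⟩ := ihf
    obtain ⟨q, hq⟩ := ihg
    exact ⟨p + q, fun w => by rw [map_add, ← hp, ← hq]; rfl⟩
  | mul f g hf hg ihf ihg =>
    obtain ⟨p, hp⟩ := ihf
    obtain ⟨q, hq⟩ := ihg
    exact ⟨p * q, fun w => by rw [map_mul, ← hp, ← hq]; rfl⟩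

theorem eq_zero_or_eq_zero_of_mem_polyFun [FiniteDimensional ℂ W] {f g : W → ℂ}
    (hf : f ∈ polyFun W) (hg : g ∈ polyFun W) (h : ∀ w, f w * g w = 0) :
    (∀ w, f w = 0) ∨ ∀ w, g w = 0 := by
  let b := Module.finBasis ℂ W
  obtain ⟨p, hp⟩ := exists_eval_eq_of_mem_polyFun b hf
  obtain ⟨q, hq⟩ := exists_eval_eq_of_mem_polyFun b hg
  have hpq : p * q = 0 := by
    refine MvPolynomial.funext fun c => ?_
    have h1 := h (b.equivFun.symm c)
    rw [hp, hq, ← map_mul] at h1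
    have h2 : ⇑(b.repr (b.equivFun.symm c)) = c := b.equivFun.apply_symm_apply c
    rwa [h2] at h1
  rcases mul_eq_zero.mp hpq with h0 | h0
  · exact Or.inl fun w => by rw [hp, h0, map_zero]
  · exact Or.inr fun w => by rw [hq, h0, map_zero]

/-- The coordinate ring of the image of a polynomial map from a vector space is a domain. -/
theorem isDomain_coordRing {U : Type*} [AddCommGroup U] [Module ℂ U] [FiniteDimensional ℂ U]
    {X : Set W} (γ : U → W) (hγX : Set.range γ = X)
    (hγ : ∀ l : Dual ℂ W, (fun u => l (γ u)) ∈ polyFun U) : IsDomain (coordRing X) := by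
  have hmem : ∀ u, γ u ∈ X := fun u => hγX ▸ Set.mem_range_self u
  -- Pullback along `γ` is injective on `coordRing X`, by surjectivity onto `X`, and lands in
  -- polynomial functions on `U`, where there are no zero divisors.
  have hpull : ∀ f : coordRing X, (fun u => f.1 ⟨γ u, hmem u⟩) ∈ polyFun U := by
    rintro ⟨f, hf⟩
    induction hf using Algebra.adjoin_induction with
    | mem f hf =>
      obtain ⟨l, rfl⟩ := hf
      exact hγ l
    | algebraMap c => exact (polyFun U).algebraMap_mem c
    | add f g hf hg ihf ihg => exact add_mem ihf ihg
    | mul f g hf hg ihf ihg => exact mul_mem ihf ihg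
  have hzero : ∀ f : coordRing X, (∀ u, f.1 ⟨γ u, hmem u⟩ = 0) → f = 0 := by
    intro f hf
    ext ⟨x, hx⟩
    obtain ⟨u, rfl⟩ := hγX.symm ▸ hx
    exact hf u
  have : Nontrivial (coordRing X) := by
    refine ⟨0, 1, fun h => ?_⟩
    have := congrFun (congrArg Subtype.val h) ⟨γ 0, hmem 0⟩
    exact zero_ne_one this
  have : NoZeroDivisors (coordRing X) := ⟨fun {f g} hfg => by
    refine (eq_zero_or_eq_zero_of_mem_polyFun (hpull f) (hpull g) fun u => ?_).imp
      (hzero f) (hzero g)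
    exact congrFun (congrArg Subtype.val hfg) ⟨γ u, hmem u⟩⟩
  exact NoZeroDivisors.to_isDomain _

/-- The `ℂ`-points of the coordinate ring of a closed set are the points of the set. -/
theorem exists_eq_eval_of_algHom [FiniteDimensional ℂ W] {X : Set W} (hX : IsPolyClosed X)
    (Φ : coordRing X →ₐ[ℂ] ℂ) : ∃ x : X, ∀ f : coordRing X, Φ f = f.1 x := by
  let b := Module.finBasis ℂ W
  -- The only candidate: the point whose coordinates are the values of `Φ` on the coordinate
  -- functions. A polynomial that vanishes on `X` is zero in `coordRing X`, so it vanishes at `w`.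
  let w : W := b.equivFun.symm fun i => Φ (linFun X (b.coord i))
  have hw : ⇑(b.repr w) = fun i => Φ (linFun X (b.coord i)) := b.equivFun.apply_symm_apply _
  have hΦ : ∀ p, Φ (coordEval b X p) = MvPolynomial.eval (b.repr w) p := by
    intro p
    rw [hw, coordEval, ← AlgHom.comp_apply, MvPolynomial.comp_aeval]
    rfl
  have hwX : w ∈ X := by
    by_contra hwX
    obtain ⟨f, hf, hf0, hfw⟩ := hX w hwX
    obtain ⟨p, hp⟩ := exists_eval_eq_of_mem_polyFun b hf
    have h0 : coordEval b X p = 0 := by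
      ext x
      rw [coordEval_apply, ← hp, hf0 x x.2]
      rfl
    apply hfw
    rw [hp, ← hΦ, h0, map_zero]
  refine ⟨⟨w, hwX⟩, fun f => ?_⟩
  obtain ⟨p, rfl⟩ := coordEval_surjective b X f
  rw [hΦ, coordEval_apply]

/-- If the center `Z` of a linear projection meets the closed cone `X` only in the origin, then the
coordinate ring of `X` is finite over the ring that is generated by the coordinates of the
projection. -/
theorem finite_coordRing [FiniteDimensional ℂ W] {X : Set W} (hX : IsPolyClosed X)
    (hcone : ∀ t : ℂ, t ≠ 0 → ∀ x ∈ X, t • x ∈ X) (Z : Submodule ℂ W)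
    (hXZ : ∀ x ∈ X, x ∈ Z → x = 0) : Module.Finite (projRing X Z) (coordRing X) := by
  classical
  let b := Module.finBasis ℂ W
  let P := MvPolynomial (Fin (finrank ℂ W)) ℂ
  let ev : P →ₐ[ℂ] coordRing X := coordEval b X
  have hev : ∀ (p : P) (x : X), (ev p).1 x = MvPolynomial.eval (b.repr x) p := coordEval_apply b X
  let form : Dual ℂ (W ⧸ Z) → P := fun l =>
    ∑ i, MvPolynomial.C (l (Z.mkQ (b i))) * MvPolynomial.X i
  have hform : ∀ l, ev (form l) = linFun X (l ∘ₗ Z.mkQ) := fun l =>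
    (linFun_eq_coordEval b X (l ∘ₗ Z.mkQ)).symm
  have hform1 : ∀ l, (form l).IsHomogeneous 1 := fun l =>
    MvPolynomial.IsHomogeneous.sum _ _ _ fun i _ => MvPolynomial.isHomogeneous_C_mul_X _ _
  let T : ℕ → Submodule (projRing X Z) (coordRing X) := fun n =>
    Submodule.span _ (ev '' {p | p.IsHomogeneous n})
  -- Multiples of elements of `J` have components whose degree can be lowered by one at the cost of
  -- coefficients in `projRing X Z`. At `n = 0` the truncated `n - 1` makes the condition vacuous.
  let J : Ideal P :=
    { carrier := {p | ∀ a n, ev (MvPolynomial.homogeneousComponent n (a * p)) ∈ T (n - 1)}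
      add_mem' := fun {p q} hp hq a n => by
        rw [mul_add, map_add, map_add]
        exact add_mem (hp a n) (hq a n)
      zero_mem' := fun a n => by simp
      smul_mem' := fun c p hp a n => by
        rw [smul_eq_mul, ← mul_assoc]
        exact hp _ n }
  have hJker : ∀ p, ev p = 0 → p ∈ J := by
    intro p hp a n
    suffices ev (MvPolynomial.homogeneousComponent n (a * p)) = 0 by rw [this]; exact zero_mem _
    ext x
    -- This uses the cone property: the ideal of a cone contains the homogeneous components of its
    -- members.
    rw [hev]
    refine eval_homogeneousComponent_eq_zero _ _ (fun t ht => ?_) n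
    have h1 := hev (a * p) ⟨t • x.1, hcone t ht x x.2⟩
    rw [map_mul, hp, mul_zero] at h1
    rw [← Finsupp.coe_smul, ← map_smul]
    exact h1.symm
  have hJform : ∀ l, form l ∈ J := by
    intro l a n
    induction a using MvPolynomial.induction_on' with
    | add p q hp hq =>
      rw [add_mul, map_add, map_add]
      exact add_mem hp hq
    | monomial d c =>
      have h1 : (MvPolynomial.monomial d c : P).IsHomogeneous d.degree :=
        MvPolynomial.isHomogeneous_monomial c rfl
      rw [MvPolynomial.homogeneousComponent_of_mem (h1.mul (hform1 l))]
      split_ifs with hn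
      · subst hn
        rw [map_mul, hform, mul_comm]
        exact (T _).smul_mem (⟨_, linFun_mem_projRing X Z l⟩ : projRing X Z)
          (Submodule.subset_span ⟨_, h1, rfl⟩)
      · rw [map_zero]; exact zero_mem _
  -- `J` contains the equations of `X` and those of `Z`, which meet only in the origin.
  have hzero : MvPolynomial.zeroLocus ℂ J ⊆ {0} := by
    intro c hc
    let w : W := b.equivFun.symm c
    have hw : ⇑(b.repr w) = c := b.equivFun.apply_symm_apply c
    have hwX : w ∈ X := by
      by_contra hwX
      obtain ⟨f, hf, hf0, hfw⟩ := hX w hwX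
      obtain ⟨p, hp⟩ := exists_eval_eq_of_mem_polyFun b hf
      have h0 : ev p = 0 := by
        ext x
        rw [hev, ← hp, hf0 x x.2]
        rfl
      apply hfw
      rw [hp, hw]
      exact hc p (hJker p h0)
    have hwZ : w ∈ Z := by
      rw [← Submodule.ker_mkQ Z, LinearMap.mem_ker, ← Module.forall_dual_apply_eq_zero_iff ℂ]
      intro l
      have h1 := hev (form l) ⟨w, hwX⟩
      rw [hform] at h1
      refine h1.trans ?_
      change MvPolynomial.eval (b.repr w) _ = 0
      rw [hw]
      exact hc _ (hJform l)
    have hw0 := hXZ w hwX hwZ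
    rw [Set.mem_singleton_iff, ← hw, hw0]
    simp
  -- Nullstellensatz: each variable lies in the radical of `J`.
  have hpow : ∃ k : ℕ, ∀ i, (MvPolynomial.X i : P) ^ k ∈ J := by
    have h1 : ∀ i, ∃ k : ℕ, (MvPolynomial.X i : P) ^ k ∈ J := by
      intro i
      have : (MvPolynomial.X i : P) ∈ J.radical := by
        rw [← MvPolynomial.vanishingIdeal_zeroLocus_eq_radical (K := ℂ)]
        intro c hc
        rw [Set.mem_singleton_iff.mp (hzero hc)]
        simp
      exact this
    choose k hk using h1
    exact ⟨∑ i, k i, fun i => Ideal.pow_mem_of_pow_mem J (hk i)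
      (Finset.single_le_sum (fun _ _ => Nat.zero_le _) (Finset.mem_univ i))⟩
  obtain ⟨k, hk⟩ := hpow
  have hkT : ∀ i, ev (MvPolynomial.X i ^ (k + 1)) ∈ T k := by
    intro i
    have h1 := hk i (MvPolynomial.X i) (k + 1)
    rw [← pow_succ', MvPolynomial.homogeneousComponent_eq_self] at h1
    · exact h1
    · simpa using MvPolynomial.isHomogeneous_X_pow (R := ℂ) i (k + 1)
  -- By pigeonhole, a monomial outside `B` has an exponent at least `k + 1`. Replacing that `X i ^
  -- (k + 1)` by an element of `T k` lowers the degree, so the finitely many monomials in `B`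
  -- generate.
  let B : Set (Fin (finrank ℂ W) →₀ ℕ) := {d | d.degree ≤ finrank ℂ W * k}
  have hB : B.Finite := Finsupp.finite_of_degree_le _
  let M : Submodule (projRing X Z) (coordRing X) :=
    Submodule.span _ ((fun d => ev (MvPolynomial.monomial d 1)) '' B)
  have hmon : ∀ d, ev (MvPolynomial.monomial d 1) ∈ M := by
    intro d
    induction hn : d.degree using Nat.strong_induction_on generalizing d with
    | _ n ih =>
      subst hn
      by_cases hd : d ∈ B
      · exact Submodule.subset_span ⟨d, hd, rfl⟩
      obtain ⟨i, hi⟩ : ∃ i, k + 1 ≤ d i := by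
        by_contra! hlt
        refine hd ?_
        change d.degree ≤ _
        rw [Finsupp.degree_eq_sum]
        refine (Finset.sum_le_card_nsmul _ _ k fun i _ => ?_).trans (by simp)
        have := hlt i
        omega
      obtain ⟨d', rfl⟩ : ∃ d', d = Finsupp.single i (k + 1) + d' :=
        ⟨d - Finsupp.single i (k + 1), by
          rw [add_tsub_cancel_of_le]
          exact Finsupp.single_le_iff.mpr hi⟩
      have h1 : (MvPolynomial.monomial (Finsupp.single i (k + 1) + d') 1 : P) =
          MvPolynomial.X i ^ (k + 1) * MvPolynomial.monomial d' 1 := by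
        rw [MvPolynomial.X_pow_eq_monomial, MvPolynomial.monomial_mul, one_mul]
      rw [h1, map_mul]
      have h2 := hkT i
      generalize ev (MvPolynomial.X i ^ (k + 1)) = z at h2
      induction h2 using Submodule.span_induction with
      | mem z hz =>
        obtain ⟨p, hp, rfl⟩ := hz
        have h3 : MvPolynomial.IsHomogeneous (p * MvPolynomial.monomial d' 1) (k + d'.degree) :=
          MvPolynomial.IsHomogeneous.mul hp (MvPolynomial.isHomogeneous_monomial 1 rfl)
        rw [← map_mul, MvPolynomial.as_sum (p * MvPolynomial.monomial d' 1), map_sum]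
        refine sum_mem fun e he => ?_
        have h4 : e.degree = k + d'.degree := by
          by_contra h
          exact (MvPolynomial.mem_support_iff.mp he) (h3.coeff_eq_zero h)
        rw [← mul_one (MvPolynomial.coeff e _), ← smul_eq_mul, ← MvPolynomial.smul_monomial,
          map_smul]
        refine M.smul_of_tower_mem _ (ih _ ?_ e rfl)
        rw [h4, map_add, Finsupp.degree_single]
        omega
      | zero => rw [zero_mul]; exact zero_mem _
      | add x y _ _ hx hy => rw [add_mul]; exact add_mem hx hy
      | smul a x _ hx => rw [smul_mul_assoc]; exact M.smul_mem a hx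
  refine ⟨⟨(hB.image fun d => ev (MvPolynomial.monomial d 1)).toFinset, ?_⟩⟩
  rw [Set.Finite.coe_toFinset, eq_top_iff]
  rintro r -
  obtain ⟨p, rfl⟩ := coordEval_surjective b X r
  change ev p ∈ M
  rw [p.as_sum, map_sum]
  refine sum_mem fun e _ => ?_
  rw [← mul_one (MvPolynomial.coeff e _), ← smul_eq_mul, ← MvPolynomial.smul_monomial, map_smul]
  exact M.smul_of_tower_mem _ (hmon e)

/-- A linear involution that preserves `X` and `Z` and acts trivially on the quotient by `Z`
induces an automorphism of the coordinate ring of `X`. -/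
def coordInvolution {X : Set W} {Z : Submodule ℂ W} (σ : W →ₗ[ℂ] W) (hσ : Function.Involutive σ)
    (hσX : ∀ x ∈ X, σ x ∈ X) (hσZ : ∀ w, σ w - w ∈ Z) :
    coordRing X ≃ₐ[projRing X Z] coordRing X :=
  have hmem : ∀ f : coordRing X, (fun x : X => f.1 ⟨σ x, hσX x x.2⟩) ∈ coordRing X := by
    rintro ⟨f, hf⟩
    induction hf using Algebra.adjoin_induction with
    | mem f hf =>
      obtain ⟨l, rfl⟩ := hf
      exact (linFun X (l ∘ₗ σ)).2
    | algebraMap c => exact (coordRing X).algebraMap_mem c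
    | add f g hf hg ihf ihg => exact add_mem ihf ihg
    | mul f g hf hg ihf ihg => exact mul_mem ihf ihg
  have hinv : ∀ f : coordRing X,
      (fun x : X => f.1 ⟨σ (σ x), hσX _ (hσX x x.2)⟩) = f.1 := fun f => by
    funext x
    exact congrArg f.1 (Subtype.ext (hσ x.1))
  { toFun := fun f => ⟨_, hmem f⟩
    invFun := fun f => ⟨_, hmem f⟩
    left_inv := fun f => Subtype.ext (hinv f)
    right_inv := fun f => Subtype.ext (hinv f)
    map_mul' := fun _ _ => rfl
    map_add' := fun _ _ => rfl
    commutes' := by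
      rintro ⟨f, hf⟩
      refine Subtype.ext (funext fun x => ?_)
      change f.1 ⟨σ x, hσX x x.2⟩ = f.1 x
      induction hf using Algebra.adjoin_induction with
      | mem f hf =>
        obtain ⟨l, rfl⟩ := hf
        -- A generator of `projRing X Z` only sees classes modulo `Z`, and `σ` fixes these.
        change l (Z.mkQ (σ x)) = l (Z.mkQ x)
        rw [← sub_eq_zero, ← map_sub, ← map_sub, Submodule.mkQ_apply,
          (Submodule.Quotient.mk_eq_zero Z).mpr (hσZ x.1), map_zero]
      | algebraMap c => rfl
      | add f g hf hg ihf ihg => exact congrArg₂ (· + ·) ihf ihg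
      | mul f g hf hg ihf ihg => exact congrArg₂ (· * ·) ihf ihg }

end Coordinate

/-! ### From lifts of points to fibers, affine and projective. -/

section Fibers

variable {W : Type*} [AddCommGroup W] [Module ℂ W]

theorem exists_eval_eq_of_mem_projRing {X : Set W} {Z : Submodule ℂ W} {f : coordRing X}
    (hf : f ∈ projRing X Z) : ∃ G : MvPolynomial (Dual ℂ (W ⧸ Z)) ℂ,
      ∀ x : X, f.1 x = MvPolynomial.eval (fun l => l (Z.mkQ x)) G := by
  induction hf using Algebra.adjoin_induction with
  | mem f hf =>
    obtain ⟨l, rfl⟩ := hf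
    exact ⟨MvPolynomial.X l, fun x => by rw [MvPolynomial.eval_X]; rfl⟩
  | algebraMap c => exact ⟨MvPolynomial.C c, fun x => by rw [MvPolynomial.eval_C]; rfl⟩
  | add f g hf hg ihf ihg =>
    obtain ⟨p, hp⟩ := ihf
    obtain ⟨q, hq⟩ := ihg
    exact ⟨p + q, fun w => by rw [map_add, ← hp, ← hq]; rfl⟩
  | mul f g hf hg ihf ihg =>
    obtain ⟨p, hp⟩ := ihf
    obtain ⟨q, hq⟩ := ihg
    exact ⟨p * q, fun w => by rw [map_mul, ← hp, ← hq]; rfl⟩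

/-- Evaluation at a point. -/
def pointEval (X : Set W) (x : X) : coordRing X →ₐ[ℂ] ℂ :=
  (Pi.evalAlgHom ℂ (fun _ : X => ℂ) x).comp (coordRing X).val

/-- The points of a closed set `X` over a point of its projection correspond to the lifts of
the corresponding point of the coordinate rings. -/
theorem bijOn_pointEval [FiniteDimensional ℂ W] {X : Set W} (hX : IsPolyClosed X)
    (Z : Submodule ℂ W) (x₀ : X) :
    Set.BijOn (pointEval X) {x | Z.mkQ x = Z.mkQ x₀}
      {Φ | ∀ s : projRing X Z, Φ (algebraMap (projRing X Z) (coordRing X) s) =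
        (pointEval X x₀).comp (projRing X Z).val s} := by
  refine ⟨fun x hx => ?_, fun x _ y _ hxy => ?_, fun Φ hΦ => ?_⟩
  · rintro ⟨f, hf⟩
    obtain ⟨G, hG⟩ := exists_eval_eq_of_mem_projRing hf
    change f.1 x = f.1 x₀
    rw [hG, hG]
    congr! 2
    funext l
    exact congrArg l hx
  · ext
    rw [← sub_eq_zero, ← Module.forall_dual_apply_eq_zero_iff ℂ]
    intro l
    rw [map_sub, sub_eq_zero]
    exact DFunLike.congr_fun hxy (linFun X l)
  · obtain ⟨x, hx⟩ := exists_eq_eval_of_algHom hX Φ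
    refine ⟨x, ?_, AlgHom.ext fun f => (hx f).symm⟩
    change Z.mkQ x = Z.mkQ x₀
    rw [← sub_eq_zero, ← Module.forall_dual_apply_eq_zero_iff ℂ]
    intro l
    rw [map_sub, sub_eq_zero]
    exact (hx _).symm.trans (hΦ ⟨_, linFun_mem_projRing X Z l⟩)

/-- A linear projection of a closed irreducible cone whose center meets the cone only in the origin
has even degree over its image, if it is invariant under a nontrivial linear involution of the
cone. -/
theorem exists_even_encard_fiber [FiniteDimensional ℂ W] {X : Set W} (hX : IsPolyClosed X)
    (hcone : ∀ t : ℂ, t ≠ 0 → ∀ x ∈ X, t • x ∈ X) [IsDomain (coordRing X)] (Z : Submodule ℂ W)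
    (hXZ : ∀ x ∈ X, x ∈ Z → x = 0) (σ : W →ₗ[ℂ] W) (hσ : Function.Involutive σ)
    (hσX : ∀ x ∈ X, σ x ∈ X) (hσZ : ∀ w, σ w - w ∈ Z) (hσ1 : ∃ x ∈ X, σ x ≠ x) :
    ∃ (G : MvPolynomial (Dual ℂ (W ⧸ Z)) ℂ) (d : ℕ), Even d ∧
      (∃ x ∈ X, MvPolynomial.eval (fun l => l (Z.mkQ x)) G ≠ 0) ∧
      ∀ x₀ ∈ X, MvPolynomial.eval (fun l => l (Z.mkQ x₀)) G ≠ 0 →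
        {x | x ∈ X ∧ Z.mkQ x = Z.mkQ x₀}.encard = d := by
  have := finite_coordRing hX hcone Z hXZ
  -- Linear forms separate points, so a moved point of `X` makes the automorphism nontrivial.
  obtain ⟨g, d, hg, heven, hgd⟩ := exists_even_encard_lifts ℂ (projRing X Z) (coordRing X)
    (coordInvolution σ hσ hσX hσZ) (fun h => by
      obtain ⟨x, hx, hne⟩ := hσ1
      apply hne
      rw [← sub_eq_zero, ← Module.forall_dual_apply_eq_zero_iff ℂ]
      intro l
      rw [map_sub, sub_eq_zero]
      exact congrFun (congrArg Subtype.val (DFunLike.congr_fun h (linFun X l))) ⟨x, hx⟩)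
    (AlgEquiv.ext fun f => (coordInvolution σ hσ hσX hσZ).left_inv f)
  obtain ⟨G, hG⟩ := exists_eval_eq_of_mem_projRing g.2
  refine ⟨G, d, heven, ?_, fun x₀ hx₀ hne => ?_⟩
  · by_contra! h
    apply hg
    ext x
    exact (hG x).trans (h x x.2)
  · have hb := bijOn_pointEval hX Z ⟨x₀, hx₀⟩
    rw [← hgd ((pointEval X ⟨x₀, hx₀⟩).comp (projRing X Z).val), ← hb.image_eq,
      hb.injOn.encard_image, ← Subtype.val_injective.encard_image]
    · congr 1
      ext x
      simp [and_comm]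
    · change g.1.1 ⟨x₀, hx₀⟩ ≠ 0
      rwa [hG]

/-- The projective version of `exists_even_encard_fiber`. -/
theorem exists_hasDegreeOverImage_even [FiniteDimensional ℂ W] {X : Set W} (hX : IsPolyClosed X)
    (hcone : ∀ t : ℂ, t ≠ 0 → ∀ x ∈ X, t • x ∈ X) [IsDomain (coordRing X)] (Z : Submodule ℂ W)
    (σ : W →ₗ[ℂ] W) (hσ : Function.Involutive σ) (hσX : ∀ x ∈ X, σ x ∈ X)
    (hσZ : ∀ w, σ w - w ∈ Z) (hσ1 : ∃ x ∈ X, σ x ≠ x) (Y : Set (ℙ ℂ W))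
    (hY : ∀ (w : W) (hw : w ≠ 0), Projectivization.mk ℂ w hw ∈ Y ↔ w ∈ X)
    (hYZ : Disjoint (projSubspace Z) Y) :
    ∃ d : ℕ, HasDegreeOverImage (restrictedProjection Z Y hYZ) d ∧ Even d := by
  have hnot : ∀ (w : W) (hw : w ≠ 0), w ∈ X → Projectivization.mk ℂ w hw ∉ projSubspace Z :=
    fun w hw hwX => Set.disjoint_right.mp hYZ ((hY w hw).mpr hwX)
  have hmkQ : ∀ w, w ≠ 0 → w ∈ X → Z.mkQ w ≠ 0 := by
    intro w hw hwX h
    refine hnot w hw hwX ?_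
    rw [projSubspace, Set.mem_ofPred_eq, Projectivization.submodule_mk,
      Submodule.span_singleton_le_iff_mem]
    simpa using h
  have hXZ : ∀ x ∈ X, x ∈ Z → x = 0 := by
    intro x hx hxZ
    by_contra h0
    exact hmkQ x h0 hx (by simpa using hxZ)
  obtain ⟨G, d, hd, ⟨x₀, hx₀, hGx₀⟩, hfib⟩ :=
    exists_even_encard_fiber hX hcone Z hXZ σ hσ hσX hσZ hσ1
  have hval : ∀ (w : W) (hw : w ≠ 0) (hwX : w ∈ X),
      restrictedProjection Z Y hYZ ⟨Projectivization.mk ℂ w hw, (hY w hw).mpr hwX⟩ =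
        Projectivization.mk ℂ (Z.mkQ w) (hmkQ w hw hwX) := fun w hw hwX =>
    linearProjection_mk Z w hw (hnot w hw hwX) (hmkQ w hw hwX)
  have hpoly : ∀ (t : ℂ) (u : W ⧸ Z),
      (fun l : Dual ℂ (W ⧸ Z) => l (t • u)) = t • fun l : Dual ℂ (W ⧸ Z) => l u := by
    intro t u
    funext l
    simp
  have hrep : ∀ (u : W ⧸ Z) (hu : u ≠ 0), ∃ t : ℂ, t ≠ 0 ∧
      u = t • (Projectivization.mk ℂ u hu).rep := by
    intro u hu
    obtain ⟨a, ha⟩ := Projectivization.exists_smul_eq_mk_rep ℂ u hu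
    refine ⟨(a⁻¹ : ℂˣ), Units.ne_zero _, ?_⟩
    rw [← ha]
    exact (inv_smul_smul a u).symm
  -- `G` need not be homogeneous. The closed set is where all its components vanish; off it, `G` is
  -- nonzero somewhere on the punctured line.
  refine ⟨d, ⟨{y | ∀ n, MvPolynomial.eval (fun l : Dual ℂ (W ⧸ Z) => l y.rep)
      (MvPolynomial.homogeneousComponent n G) = 0}, ?_, ?_, ?_⟩, hd⟩
  · refine ⟨Set.range fun n => MvPolynomial.homogeneousComponent n G, ?_, ?_⟩
    · rintro _ ⟨n, rfl⟩
      exact ⟨n, MvPolynomial.homogeneousComponent_isHomogeneous n G⟩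
    · ext y
      simp
  -- `x₀` may be the origin, which has no projective point; then any moved point serves, with `t =
  -- 0`.
  · obtain ⟨x₁, hx₁, h1, t, ht⟩ : ∃ x₁ ∈ X, x₁ ≠ 0 ∧ ∃ t : ℂ, Z.mkQ x₀ = t • Z.mkQ x₁ := by
      by_cases h0 : x₀ = 0
      · obtain ⟨x, hx, hne⟩ := hσ1
        refine ⟨x, hx, ?_, 0, by rw [h0, map_zero, zero_smul]⟩
        rintro rfl
        exact hne (map_zero σ)
      · exact ⟨x₀, hx₀, h0, 1, (one_smul _ _).symm⟩
    refine ⟨_, ⟨⟨_, (hY x₁ h1).mpr hx₁⟩, hval x₁ h1 hx₁⟩, fun hC => hGx₀ ?_⟩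
    obtain ⟨s, -, hs⟩ := hrep _ (hmkQ x₁ h1 hx₁)
    rw [ht, hs, smul_smul, hpoly, eval_smul_eq_sum]
    exact Finset.sum_eq_zero fun n _ => by rw [hC n, mul_zero]
  · rintro _ ⟨⟨⟨x, hxY⟩, rfl⟩, hC⟩
    induction x using Projectivization.ind with
    | h w hw =>
    have hwX := (hY w hw).mp hxY
    rw [hval w hw hwX] at hC ⊢
    obtain ⟨s, hs0, hs⟩ := hrep _ (hmkQ w hw hwX)
    obtain ⟨t, ht0, ht⟩ : ∃ t : ℂ, t ≠ 0 ∧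
        MvPolynomial.eval (fun l : Dual ℂ (W ⧸ Z) => l (Z.mkQ (t • w))) G ≠ 0 := by
      by_contra! h
      refine hC fun n => eval_homogeneousComponent_eq_zero _ _ (fun t ht => ?_) n
      have h1 := h (t * s⁻¹) (mul_ne_zero ht (inv_ne_zero hs0))
      rwa [map_smul, hs, smul_smul, mul_assoc, inv_mul_cancel₀ hs0, mul_one, hpoly] at h1
    rw [← hfib (t • w) (hcone t ht0 w hwX) ht]
    have hne : ∀ v ∈ {v | v ∈ X ∧ Z.mkQ v = Z.mkQ (t • w)}, v ≠ 0 := by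
      rintro v ⟨-, hv⟩ rfl
      rw [map_zero, map_smul] at hv
      exact smul_ne_zero ht0 (hmkQ w hw hwX) hv.symm
    -- Each line in the projective fiber contains exactly one vector over `Z.mkQ (t • w)`, because
    -- this vector is nonzero and so fixes the scalar.
    refine (Set.encard_congr (Equiv.ofBijective (fun v => ⟨⟨Projectivization.mk ℂ v.1
      (hne v.1 v.2), (hY _ _).mpr v.2.1⟩, ?_⟩) ⟨?_, ?_⟩)).symm
    · rw [Set.mem_preimage, hval v.1 (hne v.1 v.2) v.2.1, Set.mem_singleton_iff,
        Projectivization.mk_eq_mk_iff']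
      exact ⟨t, by rw [v.2.2, map_smul]⟩
    · rintro ⟨v, hv⟩ ⟨v', hv'⟩ h
      have h1 := congrArg (fun p => p.1.1) h
      simp only [Projectivization.mk_eq_mk_iff'] at h1
      obtain ⟨a, ha⟩ := h1
      have h2 := congrArg Z.mkQ ha
      rw [map_smul, hv.2, hv'.2] at h2
      have h3 : Z.mkQ (t • w) ≠ 0 := by
        rw [map_smul]
        exact smul_ne_zero ht0 (hmkQ w hw hwX)
      have h4 : a = 1 := by
        refine sub_eq_zero.mp ((smul_eq_zero.mp ?_).resolve_right h3)
        rw [sub_smul, one_smul, h2, sub_self]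
      rw [h4, one_smul] at ha
      exact Subtype.ext ha.symm
    · rintro ⟨⟨x, hxY'⟩, hx⟩
      induction x using Projectivization.ind with
      | h v hv =>
      have hvX := (hY v hv).mp hxY'
      rw [Set.mem_preimage, hval v hv hvX, Set.mem_singleton_iff,
        Projectivization.mk_eq_mk_iff'] at hx
      obtain ⟨a, ha⟩ := hx
      have ha0 : a ≠ 0 := by
        rintro rfl
        rw [zero_smul] at ha
        exact hmkQ v hv hvX ha.symm
      have h5 : t * a⁻¹ ≠ 0 := mul_ne_zero ht0 (inv_ne_zero ha0)
      refine ⟨⟨(t * a⁻¹) • v, hcone _ h5 v hvX, ?_⟩, ?_⟩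
      · rw [map_smul, map_smul, ← ha, smul_smul, mul_assoc, inv_mul_cancel₀ ha0, mul_one]
      · refine Subtype.ext (Subtype.ext ?_)
        exact (Projectivization.mk_eq_mk_iff' ..).mpr ⟨t * a⁻¹, rfl⟩

end Fibers

/-! ### The cone of decomposable vectors: closedness, irreducibility and the Plücker embedding. -/

section Decomposable

variable {V : Type*} [AddCommGroup V] [Module ℂ V]

/-- Pulled back to `ℂ^ι` along the standard basis `↦ u`, and composed with a linear form, `f`
becomes a multiple of the determinant. -/
theorem alternatingMap_matrix_apply {ι N : Type*} [Fintype ι] [DecidableEq ι] [AddCommGroup N]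
    [Module ℂ N] (f : V [⋀^ι]→ₗ[ℂ] N) (B : Matrix ι ι ℂ) (u : ι → V) :
    f (fun i => ∑ k, B i k • u k) = B.det • f u := by
  rw [← sub_eq_zero, ← Module.forall_dual_apply_eq_zero_iff ℂ]
  intro l
  let L : (ι → ℂ) →ₗ[ℂ] V := Fintype.linearCombination ℂ u
  have h2 : ∀ C : ι → ι → ℂ, (fun i => L (C i)) = fun i => ∑ k, C i k • u k := fun C => by
    funext i
    simp [L, Fintype.linearCombination_apply]
  have h := (l.compAlternatingMap (f.compLinearMap L)).eq_smul_basis_det (Pi.basisFun ℂ ι)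
  have h1 := DFunLike.congr_fun h B
  change l (f fun i => L fun k => B i k) = l (f fun i => L (Pi.basisFun ℂ ι i)) *
    (Pi.basisFun ℂ ι).det B at h1
  have h3 : (fun i => L (Pi.basisFun ℂ ι i)) = u := by
    funext i
    simp [L]
  rw [h3, h2 fun i k => B i k] at h1
  rw [map_sub, map_smul, h1, show (Pi.basisFun ℂ ι).det B = B.det from Pi.basisFun_det_apply _,
    smul_eq_mul, mul_comm, sub_eq_zero]

theorem det_mem_polyFun {U : Type*} [AddCommGroup U] [Module ℂ U] {m : ℕ}
    {A : U → Matrix (Fin m) (Fin m) ℂ} (hA : ∀ i j, (fun u => A u i j) ∈ polyFun U) :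
    (fun u => (A u).det) ∈ polyFun U := by
  have : (fun u => (A u).det) = ∑ σ : Equiv.Perm (Fin m), (Equiv.Perm.sign σ : ℤ) •
      ∏ i, fun u => A u (σ i) i := by
    funext u
    simp [Matrix.det_apply, Units.smul_def]
  rw [this]
  exact sum_mem fun σ _ => zsmul_mem (prod_mem fun i _ => hA _ _) _

theorem comp_mem_polyFun {U W : Type*} [AddCommGroup U] [Module ℂ U] [AddCommGroup W] [Module ℂ W]
    (L : U →ₗ[ℂ] W) {f : W → ℂ} (hf : f ∈ polyFun W) : (fun u => f (L u)) ∈ polyFun U := by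
  induction hf using Algebra.adjoin_induction with
  | mem f hf =>
    obtain ⟨l, rfl⟩ := hf
    exact linFun_mem_polyFun (l ∘ₗ L)
  | algebraMap c => exact (polyFun U).algebraMap_mem c
  | add f g hf hg ihf ihg => exact add_mem ihf ihg
  | mul f g hf hg ihf ihg => exact mul_mem ihf ihg

/-- The affine cone over the Grassmannian: the set of decomposable `m`-vectors. -/
def decomposables (m : ℕ) (V : Type*) [AddCommGroup V] [Module ℂ V] : Set (⋀[ℂ]^m V) :=
  Set.range (exteriorPower.ιMulti ℂ m)

theorem smul_mem_decomposables {m : ℕ} (hm : m ≠ 0) (t : ℂ) {w : ⋀[ℂ]^m V}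
    (hw : w ∈ decomposables m V) : t • w ∈ decomposables m V := by
  obtain ⟨u, rfl⟩ := hw
  let i : Fin m := ⟨0, Nat.pos_of_ne_zero hm⟩
  refine ⟨Function.update u i (t • u i), ?_⟩
  rw [AlternatingMap.map_update_smul, Function.update_eq_self]

theorem linearIndependent_of_ιMulti_ne_zero {m : ℕ} {u : Fin m → V}
    (hu : exteriorPower.ιMulti ℂ m u ≠ 0) : LinearIndependent ℂ u := by
  by_contra h
  exact hu ((exteriorPower.ιMulti ℂ m).map_linearDependent u h)

variable [FiniteDimensional ℂ V]

/-- Wedges of linear forms span the dual, and their values on wedges of vectors are determinants. -/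
theorem dual_ιMulti_mem_polyFun {m : ℕ} (l : Dual ℂ (⋀[ℂ]^m V)) :
    (fun u : Fin m → V => l (exteriorPower.ιMulti ℂ m u)) ∈ polyFun (Fin m → V) := by
  obtain ⟨η, rfl⟩ := (pairingDual_bijective m).2 l
  have hη : η ∈ Submodule.span ℂ (Set.range (exteriorPower.ιMulti ℂ m (M := Dual ℂ V))) :=
    exteriorPower.ιMulti_span ℂ m (Dual ℂ V) ▸ Submodule.mem_top
  induction hη using Submodule.span_induction with
  | mem η hη =>
    obtain ⟨f, rfl⟩ := hη
    simp only [exteriorPower.pairingDual_ιMulti_ιMulti]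
    exact det_mem_polyFun fun i j => linFun_mem_polyFun
      (f j ∘ₗ (LinearMap.proj i : (Fin m → V) →ₗ[ℂ] V))
  | zero =>
    rw [map_zero]
    exact zero_mem (polyFun (Fin m → V))
  | add η ξ _ _ hη hξ =>
    rw [map_add]
    exact add_mem hη hξ
  | smul c η _ hη =>
    rw [map_smul]
    exact (polyFun (Fin m → V)).smul_mem hη c

theorem isDomain_coordRing_decomposables (m : ℕ) : IsDomain (coordRing (decomposables m V)) :=
  isDomain_coordRing (exteriorPower.ιMulti ℂ m) rfl dual_ιMulti_mem_polyFun

/-- The contraction of an `m`-vector with all but the `i`-th of `m` linear forms. -/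
def contraction {m : ℕ} (f : Fin m → Dual ℂ V) (i : Fin m) : ⋀[ℂ]^m V →ₗ[ℂ] V :=
  (Module.evalEquiv ℂ V).symm.toLinearMap ∘ₗ LinearMap.flip
    (exteriorPower.pairingDual ℂ V m ∘ₗ
      (exteriorPower.ιMulti ℂ m (M := Dual ℂ V)).toMultilinearMap.toLinearMap f i)

theorem apply_contraction {m : ℕ} (f : Fin m → Dual ℂ V) (i : Fin m) (w : ⋀[ℂ]^m V)
    (g : Dual ℂ V) : g (contraction f i w) =
      exteriorPower.pairingDual ℂ V m (exteriorPower.ιMulti ℂ m (Function.update f i g)) w := by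
  rw [contraction, LinearMap.comp_apply, LinearEquiv.coe_coe, Module.apply_evalEquiv_symm_apply]
  rfl

/-- Cramer's rule: putting `g` in place of `f i` replaces column `i` of the matrix `f j (u i)`. -/
theorem contraction_ιMulti {m : ℕ} (f : Fin m → Dual ℂ V) (i : Fin m) (u : Fin m → V) :
    contraction f i (exteriorPower.ιMulti ℂ m u) =
      ∑ k, (Matrix.of fun i j => f j (u i)).adjugate i k • u k := by
  rw [← sub_eq_zero, ← Module.forall_dual_apply_eq_zero_iff ℂ]
  intro g
  rw [map_sub, apply_contraction, exteriorPower.pairingDual_ιMulti_ιMulti, sub_eq_zero]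
  have h := congrFun (Matrix.cramer_eq_adjugate_mulVec (Matrix.of fun i j => f j (u i))
    fun k => g (u k)) i
  rw [Matrix.cramer_apply] at h
  rw [map_sum]
  simp only [map_smul, smul_eq_mul]
  refine Eq.trans (congrArg Matrix.det ?_) h
  ext a b
  by_cases hb : b = i
  · subst hb; simp
  · simp [hb]

/-- The relations of degree `m` that characterize decomposable `m`-vectors. -/
theorem ιMulti_contraction {m : ℕ} (f : Fin m → Dual ℂ V) {w : ⋀[ℂ]^m V}
    (hw : w ∈ decomposables m V) :
    exteriorPower.ιMulti ℂ m (fun i => contraction f i w) =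
      exteriorPower.pairingDual ℂ V m (exteriorPower.ιMulti ℂ m f) w ^ (m - 1) • w := by
  obtain ⟨u, rfl⟩ := hw
  simp only [contraction_ιMulti]
  -- The power `m - 1` comes from `det (adj A) = det A ^ (m - 1)`.
  rw [alternatingMap_matrix_apply, Matrix.det_adjugate, Fintype.card_fin,
    exteriorPower.pairingDual_ιMulti_ιMulti]

/-- If `c w ≠ 0`, the relation of `ιMulti_contraction` can be solved for `w` and exhibits it as
decomposable. So at a nondecomposable `w` the relation fails, and some linear form detects this. -/
theorem isPolyClosed_decomposables {m : ℕ} (hm : m ≠ 0) : IsPolyClosed (decomposables m V) := by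
  intro w hw
  have hw0 : w ≠ 0 := by
    rintro rfl
    refine hw ?_
    have := smul_mem_decomposables (V := V) hm 0 ⟨0, rfl⟩
    rwa [zero_smul] at this
  obtain ⟨f, hf⟩ : ∃ f : Fin m → Dual ℂ V,
      exteriorPower.pairingDual ℂ V m (exteriorPower.ιMulti ℂ m f) w ≠ 0 := by
    by_contra! h
    refine hw0 ((Module.forall_dual_apply_eq_zero_iff ℂ w).mp fun l => ?_)
    obtain ⟨η, rfl⟩ := (pairingDual_bijective m).2 l
    have hη : η ∈ Submodule.span ℂ (Set.range (exteriorPower.ιMulti ℂ m (M := Dual ℂ V))) :=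
      exteriorPower.ιMulti_span ℂ m (Dual ℂ V) ▸ Submodule.mem_top
    induction hη using Submodule.span_induction with
    | mem η hη =>
      obtain ⟨f, rfl⟩ := hη
      exact h f
    | zero => simp
    | add η ξ _ _ hη hξ => rw [map_add, LinearMap.add_apply, hη, hξ, add_zero]
    | smul c η _ hη => rw [map_smul, LinearMap.smul_apply, hη, smul_zero]
  set c := exteriorPower.pairingDual ℂ V m (exteriorPower.ιMulti ℂ m f) with hc
  have hne : exteriorPower.ιMulti ℂ m (fun i => contraction f i w) - c w ^ (m - 1) • w ≠ 0 := by
    intro h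
    refine hw ?_
    have h1 := smul_mem_decomposables hm (c w ^ (m - 1))⁻¹ ⟨_, sub_eq_zero.mp h⟩
    rwa [smul_smul, inv_mul_cancel₀ (pow_ne_zero _ hf), one_smul] at h1
  rw [Ne, ← Module.forall_dual_apply_eq_zero_iff ℂ] at hne
  push Not at hne
  obtain ⟨l, hl⟩ := hne
  refine ⟨fun w => l (exteriorPower.ιMulti ℂ m (fun i => contraction f i w) -
    c w ^ (m - 1) • w), ?_, fun x hx => ?_, hl⟩
  · simp only [map_sub, map_smul, smul_eq_mul]
    refine sub_mem (comp_mem_polyFun (LinearMap.pi fun i => contraction f i)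
      (dual_ιMulti_mem_polyFun l)) (mul_mem (pow_mem (linFun_mem_polyFun c) _)
        (linFun_mem_polyFun l))
  · change l (_ - _) = 0
    rw [ιMulti_contraction f hx, sub_self, map_zero]

/-- The top exterior power of `H` is the line through the wedge of a basis; conversely, the factors
of a nonzero wedge are independent and span a suitable `H`. The condition `m ≠ 0` lets a scalar be
absorbed into a factor. -/
theorem mk_mem_grassmannian_iff {m : ℕ} (hm : m ≠ 0) (w : ⋀[ℂ]^m V) (hw : w ≠ 0) :
    Projectivization.mk ℂ w hw ∈ grassmannian m V ↔ w ∈ decomposables m V := by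
  constructor
  · rintro ⟨⟨H, hH⟩, h⟩
    have h1 := congrArg Projectivization.submodule h
    rw [plucker, Projectivization.submodule_mk'', Projectivization.submodule_mk] at h1
    obtain ⟨η, hη⟩ : w ∈ LinearMap.range (exteriorPower.map m H.subtype) :=
      h1 ▸ Submodule.mem_span_singleton_self w
    let e : Basis (Fin m) ℂ H := Module.finBasisOfFinrankEq ℂ H hH
    have hspan : η ∈ Submodule.span ℂ {exteriorPower.ιMulti ℂ m e} := by
      have h2 : η ∈ Submodule.span ℂ (Set.range (exteriorPower.ιMulti ℂ m (M := H))) :=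
        exteriorPower.ιMulti_span ℂ m H ▸ Submodule.mem_top
      refine Submodule.span_le.mpr ?_ h2
      rintro _ ⟨v, rfl⟩
      have hv : v = fun i => ∑ k, e.repr (v i) k • e k := by
        funext i
        rw [e.sum_repr]
      rw [hv]
      exact Submodule.mem_span_singleton.mpr ⟨_, (alternatingMap_matrix_apply
        (exteriorPower.ιMulti ℂ m) (Matrix.of fun i k => e.repr (v i) k) e).symm⟩
    obtain ⟨c, rfl⟩ := Submodule.mem_span_singleton.mp hspan
    rw [← hη, map_smul, exteriorPower.map_apply_ιMulti]
    exact smul_mem_decomposables hm c ⟨_, rfl⟩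
  · rintro ⟨u, rfl⟩
    have hu := linearIndependent_of_ιMulti_ne_zero hw
    let H := Submodule.span ℂ (Set.range u)
    have hH : finrank ℂ H = m := by
      rw [finrank_span_eq_card hu, Fintype.card_fin]
    refine ⟨⟨H, hH⟩, Projectivization.submodule_injective ?_⟩
    rw [plucker, Projectivization.submodule_mk'', Projectivization.submodule_mk]
    refine (Submodule.eq_of_le_of_finrank_eq ?_ ?_).symm
    · rw [Submodule.span_singleton_le_iff_mem]
      refine ⟨exteriorPower.ιMulti ℂ m fun i => (⟨u i, Submodule.subset_span ⟨i, rfl⟩⟩ : H), ?_⟩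
      rw [exteriorPower.map_apply_ιMulti]
      rfl
    · rw [finrank_span_singleton hw, finrank_range_map_subtype H hH]

end Decomposable

/-! ### Powers of a sum of decomposable bivectors. -/

section PowerOfTensor

theorem pow_succ_add_of_mul_self_eq_zero {A : Type*} [Ring A] {a b : A} (h : Commute a b)
    (ha : a * a = 0) (k : ℕ) : (a + b) ^ (k + 1) = b ^ (k + 1) + (k + 1) • (a * b ^ k) := by
  induction k with
  | zero => simp [add_comm]
  | succ k ih =>
    have h1 : b * (a * b ^ k) = a * b ^ (k + 1) := by
      rw [← mul_assoc, ← h.eq, mul_assoc, ← pow_succ']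
    have h2 : a * (a * b ^ k) = 0 := by rw [← mul_assoc, ha, zero_mul]
    rw [pow_succ', ih, add_mul, mul_add, mul_add, mul_smul_comm, mul_smul_comm, h1, h2, smul_zero,
      add_zero, ← pow_succ', succ_nsmul (a * b ^ (k + 1)) (k + 1)]
    abel

/-- The vanishing of the next power is carried along because it removes the extra binomial term in
the induction. -/
theorem sum_pow_eq_factorial_smul_prod {A : Type*} [Ring A] {n : ℕ} (a : Fin n → A)
    (hc : ∀ i j, Commute (a i) (a j)) (ha : ∀ i, a i * a i = 0) :
    (∑ i, a i) ^ n = n.factorial • (List.ofFn a).prod ∧ (∑ i, a i) ^ (n + 1) = 0 := by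
  induction n with
  | zero => simp
  | succ n ih =>
    obtain ⟨h1, h2⟩ := ih (fun i => a i.succ) (fun i j => hc _ _) fun i => ha _
    have h3 : Commute (a 0) (∑ i : Fin n, a i.succ) := Commute.sum_right _ _ _ fun i _ => hc _ _
    rw [Fin.sum_univ_succ, List.ofFn_succ, List.prod_cons]
    constructor
    · rw [pow_succ_add_of_mul_self_eq_zero h3 (ha 0), h2, zero_add, h1, mul_smul_comm, smul_smul,
        Nat.factorial_succ]
    · rw [pow_succ_add_of_mul_self_eq_zero h3 (ha 0), h2, mul_zero, smul_zero, pow_succ, h2,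
        zero_mul, add_zero]

variable {M : Type*} [AddCommGroup M] [Module ℂ M]

theorem ι_mul_ι_mul_self (x y : M) :
    ExteriorAlgebra.ι ℂ x * ExteriorAlgebra.ι ℂ y *
      (ExteriorAlgebra.ι ℂ x * ExteriorAlgebra.ι ℂ y) = 0 := by
  have h := eq_neg_of_add_eq_zero_left (ExteriorAlgebra.ι_add_mul_swap (R := ℂ) y x)
  rw [mul_assoc, ← mul_assoc _ _ (ExteriorAlgebra.ι ℂ y), h, neg_mul, mul_assoc,
    ExteriorAlgebra.ι_sq_zero]
  simp

theorem commute_ι_mul_ι (x y z w : M) :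
    Commute (ExteriorAlgebra.ι ℂ x * ExteriorAlgebra.ι ℂ y)
      (ExteriorAlgebra.ι ℂ z * ExteriorAlgebra.ι ℂ w) := by
  have h : ∀ z : M, Commute (ExteriorAlgebra.ι ℂ x * ExteriorAlgebra.ι ℂ y)
      (ExteriorAlgebra.ι ℂ z) := fun z => by
    have h1 := eq_neg_of_add_eq_zero_left (ExteriorAlgebra.ι_add_mul_swap (R := ℂ) y z)
    have h2 := eq_neg_of_add_eq_zero_left (ExteriorAlgebra.ι_add_mul_swap (R := ℂ) x z)
    change _ * _ * _ = _ * (_ * _)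
    rw [mul_assoc, h1, mul_neg, ← mul_assoc, h2, neg_mul, neg_neg, mul_assoc]
  exact (h z).mul_right (h w)

/-- The equivalence of `Fin (2 * m)` with `Fin 2 × Fin m` that lists the pairs in the order
`(0, 0), (1, 0), (0, 1), (1, 1), …`. -/
def interleave (m : ℕ) : Fin (2 * m) ≃ Fin 2 × Fin m :=
  ((Equiv.prodComm _ _).trans (finProdFinEquiv.trans (finCongr (mul_comm m 2)))).symm

theorem interleave_symm_val (m : ℕ) (a : Fin 2) (i : Fin m) :
    ((interleave m).symm (a, i)).val = 2 * i + a := by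
  simp [interleave, add_comm]

/-- The top power of a sum of `m` decomposable bivectors. -/
theorem wedgePow_sum {m : ℕ} (x : Fin 2 × Fin m → M) :
    wedgePow m (∑ i, exteriorPower.ιMulti ℂ 2 fun a => x (a, i)) =
      (m.factorial : ℂ) • exteriorPower.ιMulti ℂ (2 * m) (x ∘ interleave m) := by
  apply Subtype.ext
  have h1 : ∀ i, ExteriorAlgebra.ιMulti ℂ 2 (fun a => x (a, i)) =
      ExteriorAlgebra.ι ℂ (x (0, i)) * ExteriorAlgebra.ι ℂ (x (1, i)) := fun i => by
    simp [ExteriorAlgebra.ιMulti_apply]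
    rfl
  have h2 : ((∑ i, exteriorPower.ιMulti ℂ 2 fun a => x (a, i) : ⋀[ℂ]^2 M) :
      ExteriorAlgebra ℂ M) =
      ∑ i, ExteriorAlgebra.ι ℂ (x (0, i)) * ExteriorAlgebra.ι ℂ (x (1, i)) := by
    rw [Submodule.coe_sum]
    exact Finset.sum_congr rfl fun i _ => h1 i
  change (_ : ExteriorAlgebra ℂ M) ^ m = (m.factorial : ℂ) •
    ExteriorAlgebra.ιMulti ℂ (2 * m) (x ∘ interleave m)
  rw [h2, (sum_pow_eq_factorial_smul_prod _ (fun i j => commute_ι_mul_ι _ _ _ _)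
    (fun i => ι_mul_ι_mul_self _ _)).1, Nat.cast_smul_eq_nsmul]
  congr 1
  rw [ExteriorAlgebra.ιMulti_apply, List.ofFn_mul', List.prod_flatten, List.map_ofFn]
  congr 2
  funext i
  rw [← h1, ExteriorAlgebra.ιMulti_apply]
  change _ = (List.ofFn _).prod
  congr 2
  funext a
  congr 1
  change x (a, i) = x _
  congr 1
  rw [← Equiv.symm_apply_eq]
  apply Fin.ext
  rw [interleave_symm_val]

end PowerOfTensor

/-! ### Top forms in two blocks of variables and the Hodge star. -/

section TopForm

variable {V : Type*} [AddCommGroup V] [Module ℂ V]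

/-- The splitting of `Fin (2 * m)` into two blocks of length `m`. -/
def blocks (m : ℕ) : Fin (2 * m) ≃ Fin m ⊕ Fin m :=
  (finCongr (two_mul m)).trans finSumFinEquiv.symm

/-- A linear form on `⋀²ᵐ V` as an alternating form in two blocks of `m` variables. -/
def blockForm {m : ℕ} (Ω : Dual ℂ (⋀[ℂ]^(2 * m) V)) : V [⋀^(Fin m ⊕ Fin m)]→ₗ[ℂ] ℂ :=
  (Ω.compAlternatingMap (exteriorPower.ιMulti ℂ (2 * m))).domDomCongr (blocks m)

theorem blockForm_apply {m : ℕ} (Ω : Dual ℂ (⋀[ℂ]^(2 * m) V)) (v : Fin m ⊕ Fin m → V) :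
    blockForm Ω v = Ω (exteriorPower.ιMulti ℂ (2 * m) (v ∘ blocks m)) := rfl

theorem wedge_ιMulti {m : ℕ} (u v : Fin m → V) :
    wedge V m (exteriorPower.ιMulti ℂ m u) (exteriorPower.ιMulti ℂ m v) =
      exteriorPower.ιMulti ℂ (2 * m) (Sum.elim u v ∘ blocks m) := by
  apply Subtype.ext
  change ExteriorAlgebra.ιMulti ℂ m u * ExteriorAlgebra.ιMulti ℂ m v =
    ExteriorAlgebra.ιMulti ℂ (2 * m) (Sum.elim u v ∘ blocks m)
  have hcast : ∀ {n n' : ℕ} (h : n = n') (z : Fin n' → V),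
      ExteriorAlgebra.ιMulti ℂ n' z = ExteriorAlgebra.ιMulti ℂ n (z ∘ Fin.cast h) := by
    rintro n _ rfl z; rfl
  rw [ExteriorAlgebra.ιMulti_mul_ιMulti, hcast (two_mul m)]
  congr 1
  funext i
  simp only [Function.comp_apply, blocks, Equiv.trans_apply, finCongr_apply]
  generalize Fin.cast (two_mul m) i = j
  induction j using Fin.addCases with
  | left j => rw [Fin.append_left, finSumFinEquiv_symm_apply_castAdd]; rfl
  | right j => rw [Fin.append_right, finSumFinEquiv_symm_apply_natAdd]; rfl

theorem hodgeStar_ιMulti [FiniteDimensional ℂ V] {m : ℕ} (Ω : Dual ℂ (⋀[ℂ]^(2 * m) V))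
    (b : Basis (Fin m ⊕ Fin m) ℂ V) :
    hodgeStar m Ω (exteriorPower.ιMulti ℂ m (b ∘ Sum.inl)) =
      blockForm Ω b • exteriorPower.ιMulti ℂ m fun j => b.coord (Sum.inr j) := by
  rw [hodgeStar, LinearMap.comp_apply, LinearEquiv.coe_coe, LinearEquiv.symm_apply_eq, map_smul]
  refine exteriorPower.linearMap_ext (AlternatingMap.ext fun v => ?_)
  change Ω (wedge V m (exteriorPower.ιMulti ℂ m (b ∘ Sum.inl)) (exteriorPower.ιMulti ℂ m v)) =
    blockForm Ω b * exteriorPower.pairingDual ℂ V m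
      (exteriorPower.ιMulti ℂ m fun j => b.coord (Sum.inr j)) (exteriorPower.ιMulti ℂ m v)
  rw [wedge_ιMulti, ← blockForm_apply, (blockForm Ω).eq_smul_basis_det b,
    exteriorPower.pairingDual_ιMulti_ιMulti]
  simp only [AlternatingMap.smul_apply, smul_eq_mul, Basis.det_self, mul_one]
  congr 1
  rw [Basis.det_apply]
  -- The first block consists of basis vectors, so the matrix is block triangular and only the
  -- second-block coordinates of `v` matter.
  have : b.toMatrix (Sum.elim (b ∘ Sum.inl) v) = Matrix.fromBlocks 1
      (Matrix.of fun i j => b.coord (Sum.inl i) (v j)) 0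
      (Matrix.of fun i j => b.coord (Sum.inr i) (v j)) := by
    ext (i | i) (j | j) <;> simp [Basis.toMatrix_apply, Matrix.one_apply, Finsupp.single_apply,
      eq_comm]
  rw [this, Matrix.det_fromBlocks_zero₂₁, Matrix.det_one, one_mul, ← Matrix.det_transpose]
  rfl

theorem sign_sumComm (m : ℕ) :
    Equiv.Perm.sign (Equiv.sumComm (Fin m) (Fin m) : Equiv.Perm (Fin m ⊕ Fin m)) = (-1) ^ m := by
  have h : (Equiv.sumComm (Fin m) (Fin m) : Equiv.Perm (Fin m ⊕ Fin m)) =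
      (Equiv.boolProdEquivSum (Fin m)).permCongr
        (Equiv.prodCongrLeft fun _ : Fin m => Equiv.swap false true) := by
    ext x
    rcases x with i | i <;> simp [Equiv.permCongr_apply, Equiv.boolProdEquivSum]
  rw [h, Equiv.Perm.sign_permCongr, Equiv.Perm.sign_prodCongrLeft]
  simp

end TopForm

/-! ### Darboux bases and the square of the volume form. -/

section Symplectic

variable {V : Type*} [AddCommGroup V] [Module ℂ V] {m : ℕ} (ω : LinearMap.BilinForm ℂ V)

/-- `d (0, ·), d (1, ·)` are the two halves of a symplectic family. -/
def IsDarboux {ι : Type*} [DecidableEq ι] (ω : LinearMap.BilinForm ℂ V) (d : Fin 2 × ι → V) :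
    Prop :=
  ∀ i j, ω (d (0, i)) (d (0, j)) = 0 ∧ ω (d (1, i)) (d (1, j)) = 0 ∧
    ω (d (0, i)) (d (1, j)) = if i = j then 1 else 0

variable {ω}

theorem IsDarboux.apply_one_zero {ι : Type*} [DecidableEq ι] {d : Fin 2 × ι → V}
    (hd : IsDarboux ω d) (halt : ω.IsAlt) (i j : ι) :
    ω (d (1, i)) (d (0, j)) = if i = j then -1 else 0 := by
  rw [← halt.neg_eq, (hd j i).2.2]
  by_cases h : i = j
  · simp [h]
  · simp [h, Ne.symm h]

theorem IsDarboux.apply_sum {ι : Type*} [Fintype ι] [DecidableEq ι] {d : Fin 2 × ι → V}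
    (hd : IsDarboux ω d) (halt : ω.IsAlt) (c : Fin 2 × ι → ℂ) (i : ι) :
    ω (d (0, i)) (∑ k, c k • d k) = c (1, i) ∧ ω (d (1, i)) (∑ k, c k • d k) = -c (0, i) := by
  simp [Fintype.sum_prod_type, (hd i _).1, (hd i _).2.1, (hd i _).2.2, hd.apply_one_zero halt]

theorem IsDarboux.linearIndependent {ι : Type*} [Fintype ι] [DecidableEq ι] {d : Fin 2 × ι → V}
    (hd : IsDarboux ω d) (halt : ω.IsAlt) : LinearIndependent ℂ d := by
  rw [Fintype.linearIndependent_iff]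
  rintro c hc ⟨a, i⟩
  have h := hd.apply_sum halt c i
  rw [hc, map_zero, map_zero] at h
  fin_cases a
  · exact neg_eq_zero.mp h.2.symm
  · exact h.1.symm

theorem det_toMatrix_darboux (halt : ω.IsAlt) {d : Basis (Fin 2 × Fin m) ℂ V}
    (hd : IsDarboux ω d) : (LinearMap.BilinForm.toMatrix d ω).det = 1 := by
  have : LinearMap.BilinForm.toMatrix d ω =
      Matrix.blockDiagonal fun _ : Fin m => !![0, 1; -1, 0] := by
    ext ⟨a, i⟩ ⟨b, j⟩
    rw [LinearMap.BilinForm.toMatrix_apply, Matrix.blockDiagonal_apply]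
    fin_cases a <;> fin_cases b <;> simp [(hd i j).1, (hd i j).2.1, (hd i j).2.2,
      hd.apply_one_zero halt]
  rw [this, Matrix.det_blockDiagonal]
  simp [Matrix.det_fin_two]

variable [FiniteDimensional ℂ V]

/-- Symplectic Gram–Schmidt, adding one hyperbolic pair at a time. -/
theorem exists_isDarboux (halt : ω.IsAlt) (hω : ω.Nondegenerate) (hV : finrank ℂ V = 2 * m)
    (k : ℕ) (hk : k ≤ m) : ∃ d : Fin 2 × Fin k → V, IsDarboux ω d := by
  induction k with
  | zero => exact ⟨0, fun i => i.elim0⟩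
  | succ k ih =>
    obtain ⟨d, hd⟩ := ih (by omega)
    let L : V →ₗ[ℂ] (Fin 2 × Fin k → ℂ) := LinearMap.pi fun p => ω (d p)
    obtain ⟨x, hx, hx0⟩ : ∃ x, L x = 0 ∧ x ≠ 0 := by
      have hker : LinearMap.ker L ≠ ⊥ := LinearMap.ker_ne_bot_of_finrank_lt (by
        rw [hV, Module.finrank_fintype_fun_eq_card]
        simp
        omega)
      obtain ⟨x, hx, hx0⟩ := Submodule.exists_mem_ne_zero_of_ne_bot hker
      exact ⟨x, hx, hx0⟩
    have hdx : ∀ p, ω (d p) x = 0 := fun p => congrFun hx p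
    have hxd : ∀ p, ω x (d p) = 0 := fun p => by rw [← halt.neg_eq, hdx, neg_zero]
    obtain ⟨y, hy⟩ : ∃ y, ω x y ≠ 0 := by
      by_contra! h
      exact hx0 (hω.1 x h)
    let z : V := (ω x y)⁻¹ • y
    have hxz : ω x z = 1 := by simp [z, hy]
    -- The correction makes `f` orthogonal to the earlier pairs; `ω x f` stays 1 because `x` is
    -- orthogonal to them too.
    let f : V := z - ∑ p : Fin 2 × Fin k, (![- ω (d (1, p.2)) z, ω (d (0, p.2)) z] p.1) • d p
    have hxf : ω x f = 1 := by
      simp only [f, map_sub, map_sum, map_smul, hxd, smul_zero, Finset.sum_const_zero, sub_zero,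
        hxz]
    have hdf : ∀ p, ω (d p) f = 0 := by
      rintro ⟨a, i⟩
      have h := hd.apply_sum halt
        (fun p : Fin 2 × Fin k => ![- ω (d (1, p.2)) z, ω (d (0, p.2)) z] p.1) i
      fin_cases a
      · simp [f, map_sub, h.1]
      · simp [f, map_sub, h.2]
    have hfd : ∀ p, ω f (d p) = 0 := fun p => by rw [← halt.neg_eq, hdf, neg_zero]
    refine ⟨fun p => Fin.cons (α := fun _ => V) (![x, f] p.1) (fun i => d (p.1, i)) p.2,
      fun i j => ?_⟩
    refine Fin.cases ?_ (fun i => ?_) i <;> refine Fin.cases ?_ (fun j => ?_) j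
    · simp [hxf, halt.self_eq_zero]
    · simp [hxd, hfd, (Fin.succ_ne_zero j).symm]
    · simp [hdx, hdf, Fin.succ_ne_zero i]
    · simpa using hd i j

theorem exists_darboux_basis (halt : ω.IsAlt) (hω : ω.Nondegenerate) (hV : finrank ℂ V = 2 * m) :
    ∃ d : Basis (Fin 2 × Fin m) ℂ V, IsDarboux ω d := by
  obtain ⟨d, hd⟩ := exists_isDarboux halt hω hV m le_rfl
  refine ⟨basisOfLinearIndependentOfCardEqFinrank' d (hd.linearIndependent halt) ?_, ?_⟩
  · simp [hV]
  · simpa using hd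

theorem symplecticTensor_eq_sum (halt : ω.IsAlt) {d : Basis (Fin 2 × Fin m) ℂ V}
    (hd : IsDarboux ω d) : symplecticTensor ω halt =
      ∑ i, exteriorPower.ιMulti ℂ 2 fun a => d.coord (a, i) := by
  rw [symplecticTensor, LinearEquiv.symm_apply_eq, map_sum]
  refine exteriorPower.linearMap_ext (AlternatingMap.ext fun v => ?_)
  rw [exteriorPower.alternatingMapLinearEquiv_comp_ιMulti, LinearMap.compAlternatingMap_apply,
    LinearMap.sum_apply]
  change ω (v 0) (v 1) = ∑ i, exteriorPower.pairingDual ℂ V 2 _ _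
  have h1 := fun i => hd.apply_sum halt (d.repr (v 1)) i
  simp only [d.sum_repr] at h1
  conv_lhs => rw [← d.sum_repr (v 0)]
  simp only [exteriorPower.pairingDual_ιMulti_ιMulti, Matrix.det_fin_two, map_sum,
    LinearMap.sum_apply, Fintype.sum_prod_type, Fin.sum_univ_two, ← Finset.sum_add_distrib]
  refine Finset.sum_congr rfl fun i _ => ?_
  simp [(h1 i).1, (h1 i).2]
  ring

/-- The `m`-th power of the tensor is `m!` times the wedge of the dual basis, so the normalization
leaves only the sign. -/
theorem volumeForm_darboux (halt : ω.IsAlt) {d : Basis (Fin 2 × Fin m) ℂ V}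
    (hd : IsDarboux ω d) :
    volumeForm m ω halt (exteriorPower.ιMulti ℂ (2 * m) (d ∘ interleave m)) =
      (-1) ^ m.choose 2 := by
  have h : exteriorPower.pairingDual ℂ V (2 * m)
      (exteriorPower.ιMulti ℂ (2 * m) ((fun p => d.coord p) ∘ interleave m))
      (exteriorPower.ιMulti ℂ (2 * m) (d ∘ interleave m)) = 1 := by
    rw [exteriorPower.pairingDual_ιMulti_ιMulti, ← Matrix.det_one (n := Fin (2 * m))]
    congr 1
    ext i j
    simp [Matrix.one_apply, Finsupp.single_apply]
  rw [volumeForm, symplecticTensor_eq_sum halt hd, wedgePow_sum (fun p => d.coord p), map_smul,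
    LinearMap.smul_apply, LinearMap.smul_apply]
  change _ • _ • exteriorPower.pairingDual ℂ V (2 * m) _ _ = _
  rw [h]
  have : (m.factorial : ℂ) ≠ 0 := by exact_mod_cast m.factorial_ne_zero
  simp [this]

/-- The volume form of a symplectic form is a square root of the Gram determinant. -/
theorem blockForm_volumeForm_sq (halt : ω.IsAlt) (hω : ω.Nondegenerate)
    (hV : finrank ℂ V = 2 * m) (b : Basis (Fin m ⊕ Fin m) ℂ V) :
    blockForm (volumeForm m ω halt) b ^ 2 = (LinearMap.BilinForm.toMatrix b ω).det := by
  obtain ⟨d, hd⟩ := exists_darboux_basis halt hω hV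
  let D : Basis (Fin m ⊕ Fin m) ℂ V := d.reindex ((interleave m).symm.trans (blocks m))
  have hD : blockForm (volumeForm m ω halt) D = (-1) ^ m.choose 2 := by
    rw [blockForm_apply, ← volumeForm_darboux halt hd]
    congr 2
    funext i
    simp [D]
  have hG : (LinearMap.BilinForm.toMatrix D ω).det = 1 := by
    have : LinearMap.BilinForm.toMatrix D ω = (LinearMap.BilinForm.toMatrix d ω).submatrix
        ((interleave m).symm.trans (blocks m)).symm
        ((interleave m).symm.trans (blocks m)).symm := by
      ext i j
      simp [LinearMap.BilinForm.toMatrix_apply, D]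
    rw [this, Matrix.det_submatrix_equiv_self, det_toMatrix_darboux halt hd]
  -- Both sides scale by the squared determinant of the base change from `D`, and the sign
  -- disappears on squaring.
  rw [(blockForm (volumeForm m ω halt)).eq_smul_basis_det D, AlternatingMap.smul_apply, hD,
    ← LinearMap.BilinForm.toMatrix_mul_basis_toMatrix D b, Matrix.det_mul, Matrix.det_mul,
    Matrix.det_transpose, hG, Basis.det_apply, smul_eq_mul, mul_pow, ← pow_mul, mul_comm _ 2,
    pow_mul]
  ring

end Symplectic

/-! ### The Lagrangian involution on decomposable vectors. -/

section Involution

variable {V : Type*} [AddCommGroup V] [Module ℂ V] [FiniteDimensional ℂ V]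
  {m : ℕ} {ω : LinearMap.BilinForm ℂ V}

/-- The star yields the second-block coordinate forms, and `ψ` turns them into `ω`-dual vectors,
which are orthogonal to the first block. -/
theorem lagrangianInvolution_ιMulti (halt : ω.IsAlt) (hω : ω.Nondegenerate)
    (b : Basis (Fin m ⊕ Fin m) ℂ V) :
    lagrangianInvolution m ω halt hω (exteriorPower.ιMulti ℂ m (b ∘ Sum.inl)) =
      blockForm (volumeForm m ω halt) b •
        exteriorPower.ιMulti ℂ m (ω.dualBasis hω b ∘ Sum.inr) := by
  rw [lagrangianInvolution, LinearMap.comp_apply, hodgeStar_ιMulti, map_smul,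
    exteriorPower.map_apply_ιMulti]
  congr 2
  funext j
  simp [LinearMap.BilinForm.dualBasis]

/-- With `P` the matrix of the dual basis and `G` the Gram matrix, `Pᵀ G = 1`. Hence `Ω(b) Ω(b') =
Ω(b)² det P = det G det P = 1`. -/
theorem blockForm_mul_blockForm_dualBasis (halt : ω.IsAlt) (hω : ω.Nondegenerate)
    (hV : finrank ℂ V = 2 * m) (b : Basis (Fin m ⊕ Fin m) ℂ V) :
    blockForm (volumeForm m ω halt) b * blockForm (volumeForm m ω halt) (ω.dualBasis hω b) = 1 := by
  have h : (b.toMatrix (ω.dualBasis hω b)).transpose * LinearMap.BilinForm.toMatrix b ω = 1 := by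
    ext i j
    have h1 := LinearMap.BilinForm.apply_dualBasis_left hω b i j
    rw [← b.sum_repr (ω.dualBasis hω b i)] at h1
    simp only [map_sum, LinearMap.sum_apply, map_smul, LinearMap.smul_apply, smul_eq_mul] at h1
    simp only [Matrix.mul_apply, Matrix.transpose_apply, LinearMap.BilinForm.toMatrix_apply,
      Basis.toMatrix_apply, h1, Matrix.one_apply, eq_comm]
  have h2 := congrArg Matrix.det h
  rw [Matrix.det_mul, Matrix.det_transpose, Matrix.det_one,
    ← blockForm_volumeForm_sq halt hω hV b, ← Basis.det_apply] at h2
  rw [(blockForm (volumeForm m ω halt)).eq_smul_basis_det b]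
  simp only [AlternatingMap.smul_apply, smul_eq_mul, Basis.det_self, mul_one]
  rw [← h2]
  ring

theorem exists_basis_comp_inl_eq (hV : finrank ℂ V = 2 * m) {u : Fin m → V}
    (hu : LinearIndependent ℂ u) : ∃ b : Basis (Fin m ⊕ Fin m) ℂ V, b ∘ Sum.inl = u := by
  obtain ⟨H, hH⟩ := Submodule.exists_isCompl (Submodule.span ℂ (Set.range u))
  have h1 : finrank ℂ (Submodule.span ℂ (Set.range u)) = m := by
    rw [finrank_span_eq_card hu, Fintype.card_fin]
  have h2 : finrank ℂ H = m := by
    have := Submodule.finrank_add_eq_of_isCompl hH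
    omega
  let e : Basis (Fin m) ℂ H := Module.finBasisOfFinrankEq ℂ H h2
  have he : LinearIndependent ℂ fun i => (e i : V) :=
    e.linearIndependent.map' H.subtype H.ker_subtype
  have hspan : Submodule.span ℂ (Set.range fun i => (e i : V)) ≤ H := by
    rw [Submodule.span_le]
    rintro _ ⟨i, rfl⟩
    exact (e i).2
  have hli : LinearIndependent ℂ (Sum.elim u fun i => (e i : V)) :=
    hu.sum_type he (hH.disjoint.mono_right hspan)
  refine ⟨basisOfLinearIndependentOfCardEqFinrank' _ hli ?_, ?_⟩
  · simp [hV]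
    omega
  · rw [coe_basisOfLinearIndependentOfCardEqFinrank']
    rfl

/-- The second application uses `b'` with its blocks exchanged. The exchange contributes `(-1)^m`,
and so does the dual basis of `b'`, which is `-b` as `ω` is alternating; the signs cancel. -/
theorem lagrangianInvolution_lagrangianInvolution_ιMulti (halt : ω.IsAlt) (hω : ω.Nondegenerate)
    (hV : finrank ℂ V = 2 * m) (b : Basis (Fin m ⊕ Fin m) ℂ V) :
    lagrangianInvolution m ω halt hω (lagrangianInvolution m ω halt hω
      (exteriorPower.ιMulti ℂ m (b ∘ Sum.inl))) = exteriorPower.ιMulti ℂ m (b ∘ Sum.inl) := by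
  set b' := ω.dualBasis hω b with hb'
  let c : Basis (Fin m ⊕ Fin m) ℂ V := b'.reindex (Equiv.sumComm _ _)
  have hc : b' ∘ Sum.inr = c ∘ Sum.inl := by
    funext i
    simp [c]
  have hc' : ω.dualBasis hω c ∘ Sum.inr = fun j => (-1 : ℂ) • (b ∘ Sum.inl) j := by
    funext j
    apply LinearMap.ker_eq_bot.mp hω.ker_eq_bot
    refine c.ext fun k => ?_
    rw [Function.comp_apply, LinearMap.BilinForm.apply_dualBasis_left, Function.comp_apply,
      map_smul, LinearMap.smul_apply, smul_eq_mul, neg_one_mul, halt.neg_eq]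
    simp only [c, Basis.reindex_apply, hb', LinearMap.BilinForm.apply_dualBasis_left]
    rcases k with k | k <;> simp [eq_comm]
  have hcb : blockForm (volumeForm m ω halt) c =
      (-1) ^ m * blockForm (volumeForm m ω halt) b' := by
    have h1 : ⇑c = b' ∘ (Equiv.sumComm (Fin m) (Fin m) : Equiv.Perm (Fin m ⊕ Fin m)) := by
      funext i
      simp [c]
    rw [h1, AlternatingMap.map_perm, sign_sumComm, Units.smul_def]
    simp
  rw [lagrangianInvolution_ιMulti, map_smul, ← hb', hc, lagrangianInvolution_ιMulti, hc',
    AlternatingMap.map_smul_univ, hcb, smul_smul, smul_smul]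
  have h2 := blockForm_mul_blockForm_dualBasis halt hω hV b
  have h3 : (-1 : ℂ) ^ m * (-1) ^ m = 1 := by
    rw [← mul_pow]
    simp
  rw [Finset.prod_const, Finset.card_univ, Fintype.card_fin]
  convert one_smul ℂ _ using 2
  rw [← hb'] at h2
  linear_combination h2 * ((-1 : ℂ) ^ m * (-1) ^ m) + h3

theorem involutive_lagrangianInvolution (halt : ω.IsAlt) (hω : ω.Nondegenerate)
    (hV : finrank ℂ V = 2 * m) : Function.Involutive (lagrangianInvolution m ω halt hω) := by
  suffices h : lagrangianInvolution m ω halt hω ∘ₗ lagrangianInvolution m ω halt hω =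
      LinearMap.id from fun w => LinearMap.congr_fun h w
  refine exteriorPower.linearMap_ext (AlternatingMap.ext fun u => ?_)
  change lagrangianInvolution m ω halt hω (lagrangianInvolution m ω halt hω
    (exteriorPower.ιMulti ℂ m u)) = exteriorPower.ιMulti ℂ m u
  by_cases hu : exteriorPower.ιMulti ℂ m u = 0
  · rw [hu, map_zero, map_zero]
  · obtain ⟨b, rfl⟩ := exists_basis_comp_inl_eq hV (linearIndependent_of_ιMulti_ne_zero hu)
    exact lagrangianInvolution_lagrangianInvolution_ιMulti halt hω hV b

theorem lagrangianInvolution_mem_decomposables (hm : m ≠ 0) (halt : ω.IsAlt)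
    (hω : ω.Nondegenerate) (hV : finrank ℂ V = 2 * m) {w : ⋀[ℂ]^m V}
    (hw : w ∈ decomposables m V) : lagrangianInvolution m ω halt hω w ∈ decomposables m V := by
  obtain ⟨u, rfl⟩ := hw
  by_cases hu : exteriorPower.ιMulti ℂ m u = 0
  · rw [hu, map_zero, ← hu]
    exact ⟨u, rfl⟩
  · obtain ⟨b, rfl⟩ := exists_basis_comp_inl_eq hV (linearIndependent_of_ιMulti_ne_zero hu)
    rw [lagrangianInvolution_ιMulti]
    exact smul_mem_decomposables hm _ ⟨_, rfl⟩

/-- The Lagrangian involution moves the `m`-vectors of subspaces that are not Lagrangian. -/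
theorem lagrangianInvolution_ne_of_apply_ne_zero (halt : ω.IsAlt) (hω : ω.Nondegenerate)
    (b : Basis (Fin m ⊕ Fin m) ℂ V) (i j : Fin m) (hij : ω (b (Sum.inl i)) (b (Sum.inl j)) ≠ 0) :
    lagrangianInvolution m ω halt hω (exteriorPower.ιMulti ℂ m (b ∘ Sum.inl)) ≠
      exteriorPower.ιMulti ℂ m (b ∘ Sum.inl) := by
  intro h
  -- The form `ω (b (inl i))` vanishes on the orthogonal complement of the first block, so this
  -- pairing kills the image; on the original wedge it gives `ω (b (inl i)) (b (inl j))`.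
  have h1 := congrArg (exteriorPower.pairingDual ℂ V m (exteriorPower.ιMulti ℂ m
    (Function.update (fun k => b.coord (Sum.inl k)) j (ω (b (Sum.inl i)))))) h
  rw [lagrangianInvolution_ιMulti, map_smul, exteriorPower.pairingDual_ιMulti_ιMulti,
    exteriorPower.pairingDual_ιMulti_ιMulti, Matrix.det_eq_zero_of_column_eq_zero j,
    smul_zero] at h1
  · have h2 : (Matrix.of fun k l => Function.update (fun k => b.coord (Sum.inl k)) j
        (ω (b (Sum.inl i))) l ((b ∘ Sum.inl) k)) =
        (1 : Matrix (Fin m) (Fin m) ℂ).updateCol j fun k => ω (b (Sum.inl i)) (b (Sum.inl k)) := by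
      ext k l
      by_cases hl : l = j
      · subst hl; simp
      · simp [hl, Matrix.one_apply, Finsupp.single_apply]
    rw [h2, ← Matrix.cramer_apply, Matrix.cramer_one] at h1
    exact hij h1.symm
  · intro k
    simp only [Matrix.of_apply, Function.update_self, Function.comp_apply]
    rw [← halt.neg_eq, LinearMap.BilinForm.apply_dualBasis_left]
    simp

theorem exists_lagrangianInvolution_ne (hm : 2 ≤ m) (halt : ω.IsAlt) (hω : ω.Nondegenerate)
    (hV : finrank ℂ V = 2 * m) :
    ∃ w ∈ decomposables m V, lagrangianInvolution m ω halt hω w ≠ w := by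
  obtain ⟨d, hd⟩ := exists_darboux_basis halt hω hV
  -- This ordering starts with a hyperbolic pair, and `m ≥ 2` puts both of its vectors into the
  -- first block.
  let b : Basis (Fin m ⊕ Fin m) ℂ V := d.reindex ((interleave m).symm.trans (blocks m))
  have hb : ∀ (a : Fin 2) (k : Fin m), k.val = a.val → b (Sum.inl k) = d (a, ⟨0, by omega⟩) := by
    intro a k hk
    simp only [b, Basis.reindex_apply]
    congr 1
    rw [Equiv.symm_apply_eq, Equiv.trans_apply, ← Equiv.symm_apply_eq]
    apply Fin.ext
    rw [interleave_symm_val]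
    simp [blocks, hk]
  refine ⟨_, ⟨b ∘ Sum.inl, rfl⟩, lagrangianInvolution_ne_of_apply_ne_zero halt hω b
    ⟨0, by omega⟩ ⟨1, by omega⟩ ?_⟩
  rw [hb 0 _ rfl, hb 1 _ rfl, (hd _ _).2.2]
  simp

end Involution

/-! ### Invariance of the projection under the involution. -/

theorem sub_mem_of_eigenspace_neg_one_le {W : Type*} [AddCommGroup W] [Module ℂ W]
    {σ : W →ₗ[ℂ] W} (hσ : Function.Involutive σ) {Z : Submodule ℂ W}
    (hZ : Module.End.eigenspace σ (-1) ≤ Z) (w : W) : σ w - w ∈ Z := by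
  refine hZ (Module.End.mem_eigenspace_iff.mpr ?_)
  rw [map_sub, hσ w]
  simp

theorem linearProjection_map {W : Type*} [AddCommGroup W] [Module ℂ W]
    {σ : W →ₗ[ℂ] W} (hσ : Function.Injective σ) {Z : Submodule ℂ W} (hσZ : ∀ w, σ w - w ∈ Z)
    (x : ℙ ℂ W) (hx : x ∉ projSubspace Z) (hx' : Projectivization.map σ hσ x ∉ projSubspace Z) :
    linearProjection Z ⟨Projectivization.map σ hσ x, hx'⟩ = linearProjection Z ⟨x, hx⟩ := by
  induction x using Projectivization.ind with
  | h w hw =>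
  have h : Z.mkQ (σ w) = Z.mkQ w := by
    rw [← sub_eq_zero, ← map_sub, Submodule.mkQ_apply, Submodule.Quotient.mk_eq_zero]
    exact hσZ w
  have hw' : Z.mkQ w ≠ 0 := by
    intro h0
    refine hx ?_
    rw [projSubspace, Set.mem_ofPred_eq, Projectivization.submodule_mk,
      Submodule.span_singleton_le_iff_mem]
    simpa using h0
  have hσw : σ w ≠ 0 := fun h0 => hw (hσ (h0.trans (map_zero σ).symm))
  rw [linearProjection_mk Z w hw hx hw']
  refine (linearProjection_mk Z (σ w) hσw hx' (h ▸ hw')).trans ?_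
  congr 1

end GenWronski

end

theorem corollary1p5 (m : ℕ) (hm : 2 ≤ m)
    {V : Type*} [AddCommGroup V] [Module ℂ V] [FiniteDimensional ℂ V]
    (hV : Module.finrank ℂ V = 2 * m)
    (ω : LinearMap.BilinForm ℂ V) (halt : ω.IsAlt) (hω : ω.Nondegenerate)
    (Z : Submodule ℂ (⋀[ℂ]^m V))
    (hZ : Module.End.eigenspace (GenWronski.lagrangianInvolution m ω halt hω) (-1) ≤ Z)
    (hdisj : Disjoint (GenWronski.projSubspace Z) (GenWronski.grassmannian m V)) :
    (∃ hinv : Function.Involutive (GenWronski.lagrangianInvolution m ω halt hω),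
      ∀ y : ℙ ℂ ((⋀[ℂ]^m V) ⧸ Z),
        Set.BijOn
          (Projectivization.map (GenWronski.lagrangianInvolution m ω halt hω) hinv.injective)
          (Subtype.val '' (GenWronski.wronskiMap Z hdisj ⁻¹' {y}))
          (Subtype.val '' (GenWronski.wronskiMap Z hdisj ⁻¹' {y}))) ∧
    ∃ d : ℕ, GenWronski.HasDegreeOverImage (GenWronski.wronskiMap Z hdisj) d ∧ Even d := by
  have hm0 : m ≠ 0 := by omega
  have hinv := GenWronski.involutive_lagrangianInvolution halt hω hV
  have hσZ := GenWronski.sub_mem_of_eigenspace_neg_one_le hinv hZ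
  have hσX := fun w hw =>
    GenWronski.lagrangianInvolution_mem_decomposables (w := w) hm0 halt hω hV hw
  refine ⟨⟨hinv, fun y => ?_⟩, ?_⟩
  · have hinv' : Function.Involutive
        (Projectivization.map (GenWronski.lagrangianInvolution m ω halt hω) hinv.injective) := by
      intro x
      induction x using Projectivization.ind with
      | h w hw =>
      simp only [Projectivization.map_mk, hinv w]
    have hmaps : Set.MapsTo
        (Projectivization.map (GenWronski.lagrangianInvolution m ω halt hω) hinv.injective)
        (Subtype.val '' (GenWronski.wronskiMap Z hdisj ⁻¹' {y}))
        (Subtype.val '' (GenWronski.wronskiMap Z hdisj ⁻¹' {y})) := by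
      rintro _ ⟨⟨x, hx⟩, hxy, rfl⟩
      have hx' : Projectivization.map (GenWronski.lagrangianInvolution m ω halt hω)
          hinv.injective x ∈ GenWronski.grassmannian m V := by
        clear hxy
        induction x using Projectivization.ind with
        | h w hw =>
        rw [Projectivization.map_mk, GenWronski.mk_mem_grassmannian_iff hm0]
        exact hσX w ((GenWronski.mk_mem_grassmannian_iff hm0 w hw).mp hx)
      refine ⟨⟨_, hx'⟩, ?_, rfl⟩
      rw [Set.mem_preimage, Set.mem_singleton_iff] at hxy ⊢
      rw [← hxy]
      exact GenWronski.linearProjection_map hinv.injective hσZ x _ _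
    exact ⟨hmaps, hinv'.injective.injOn, fun x hx => ⟨_, hmaps hx, hinv' x⟩⟩
  · have := GenWronski.isDomain_coordRing_decomposables (V := V) m
    exact GenWronski.exists_hasDegreeOverImage_even
      (GenWronski.isPolyClosed_decomposables hm0)
      (fun t _ x hx => GenWronski.smul_mem_decomposables hm0 t hx) Z _ hinv hσX hσZ
      (GenWronski.exists_lagrangianInvolution_ne hm halt hω hV) _
      (GenWronski.mk_mem_grassmannian_iff hm0) hdisj
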